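/- All algebras are finite-dimensional over $\mathbb{C}$. A Leibniz algebra is a vector space with a bilinear bracket satisfying $[x,[y,z]]=[[x,y],z]-[[x,z],y]$. For a Lie algebra $N$ and $s\in\mathbb{N}$, a Leibniz algebra $R$ is said to belong to the family $R(N,s)$ if $R$ is solvable, its nilradical (largest nilpotent ideal) is isomorphic to $N$, and the nilradical has a complementary subspace of dimension $s$ in $R$. Consider the following Lie algebras with basis $e_1,\dots,e_n$ (products that are not listed and do not follow from the listed ones by skew-symmetry are zero). - $g^1_{(n,1)}$, $n$ odd: $[e_1,e_i]=e_{i+1}$ for $2\le i\le n-2$; $[e_i,e_{n-i}]=(-1)^ie_n$ for $2\le i\le\frac{n-1}{2}$. - $g^2_{(n,1)}$: $[e_1,e_i]=e_{i+1}$ for $2\le i\le n-2$; $[e_i,e_n]=e_{i+2}$ for $2\le i\le n-3$. - $g^3_{(n,1)}$, $n\ge 7$: the products of $g^2_{(n,1)}$ and $[e_2,e_i]=e_{i+3}$ for $3\le i\le n-4$. - $g^1_7$ ($n=7$): $[e_1,e_i]=e_{i+1}$ for $2\le i\le 5$; $[e_2,e_i]=e_{i+2}$ for $3\le i\le 4$;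 $[e_i,e_{7-i}]=(-1)^ie_7$ for $2\le i\le 3$. - $g^2_9$ ($n=9$): $[e_1,e_i]=e_{i+1}$ for $2\le i\le 7$; $[e_2,e_i]=e_{i+2}$ for $3\le i\le 4$; $[e_2,e_5]=3e_7$; $[e_2,e_6]=5e_8$; $[e_3,e_i]=-2e_{i+3}$ for $4\le i\le 5$; $[e_i,e_{9-i}]=(-1)^ie_9$ for $2\le i\le 4$. - $g^3_{11}$ ($n=11$): $[e_1,e_i]=e_{i+1}$ for $2\le i\le 9$; $[e_2,e_i]=e_{i+2}$ for $3\le i\le 4$; $[e_2,e_i]=-e_{i+2}$ for $6\le i\le 7$; $[e_3,e_7]=-e_{10}$; $[e_3,e_i]=e_{i+3}$ for $4\le i\le 5$; $[e_4,e_i]=e_{i+4}$ for $5\le i\le 6$; $[e_i,e_{11-i}]=(-1)^ie_{11}$ for $2\le i\le 5$. **Theorem.** (1) Let $n\ge 6$ be odd. The algebra $R(g^1_{(n,1)},2)$ with basis $e_1,\dots,e_n,x,y$ whose products are those of $g^1_{(n,1)}$ together with $$[e_1,x]=-[x,e_1]=e_1,\quad [e_i,x]=-[x,e_i]=(i-2)e_i,\quad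 [e_i,y]=-[y,e_i]=e_i\quad(2\le i\le n-1),$$ $$[e_n,x]=-[x,e_n]=(n-4)e_n,\quad [e_n,y]=-[y,e_n]=2e_n$$ (all other products being zero) is a Lie algebra and belongs to the family $R(g^1_{(n,1)},2)$, and every Leibniz algebra of this family is isomorphic to it. (2) Let $n\ge 6$. The algebra $R(g^2_{(n,1)},2)$ with basis $e_1,\dots,e_n,x,y$ whose products are those of $g^2_{(n,1)}$ together with $$[e_1,x]=-[x,e_1]=e_1,\quad [e_i,x]=-[x,e_i]=(i-2)e_i,\quad [e_i,y]=-[y,e_i]=e_i\quad(2\le i\le n-1),$$ $$[e_n,x]=-[x,e_n]=2e_n$$ (all other products being zero) is a Lie algebra and belongs to the family $R(g^2_{(n,1)},2)$, and every Leibniz algebra of this family is isomorphic to it. (3) There is no Leibniz algebra in any of the families $R(g^3_{(n,1)},2)$ ($n\ge 7$), $R(g^1_7,2)$, $R(g^2_9,2)$, $R(g^3_{11},2)$. -/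

import Mathlib

open scoped BigOperators

namespace LeibnizAlg

section General

variable {R : Type*} [AddCommGroup R] [Module ℂ R]

/-- `br` is a (right) Leibniz bracket:
`[x, [y, z]] = [[x, y], z] - [[x, z], y]`. -/
def IsLeibniz (br : R →ₗ[ℂ] R →ₗ[ℂ] R) : Prop :=
  ∀ x y z : R, br x (br y z) = br (br x y) z - br (br x z) y

/-- `br` is a Lie bracket: alternating, with the Jacobi identity. -/
def IsLie (br : R →ₗ[ℂ] R →ₗ[ℂ] R) : Prop :=
  (∀ x : R, br x x = 0) ∧
    ∀ x y z : R, br x (br y z) + br y (br z x) + br z (br x y) = 0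

/-- Two-sided ideals. -/
def IsIdeal (br : R →ₗ[ℂ] R →ₗ[ℂ] R) (I : Submodule ℂ R) : Prop :=
  ∀ x ∈ I, ∀ y : R, br x y ∈ I ∧ br y x ∈ I

/-- The derived series `L^[1] = L`, `L^[s+1] = [L^[s], L^[s]]`, numbered from `0` here.
`Submodule.map₂ br U V` is the span of all brackets of an element of `U` with one of `V`. -/
def derivedSeries (br : R →ₗ[ℂ] R →ₗ[ℂ] R) : ℕ → Submodule ℂ R
  | 0 => ⊤
  | k + 1 => Submodule.map₂ br (derivedSeries br k) (derivedSeries br k)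

def IsSolvable (br : R →ₗ[ℂ] R →ₗ[ℂ] R) : Prop :=
  ∃ k : ℕ, derivedSeries br k = ⊥

/-- The lower central series `I^1 = I`, `I^(k+1) = [I^k, I]` of a subalgebra `I` regarded as
an algebra of its own, numbered from `0` here. -/
def lowerCentralSeries (br : R →ₗ[ℂ] R →ₗ[ℂ] R) (I : Submodule ℂ R) : ℕ → Submodule ℂ R
  | 0 => I
  | k + 1 => Submodule.map₂ br (lowerCentralSeries br I k) I

/-- Ideals that are nilpotent as algebras. -/
def IsNilpotentIdeal (br : R →ₗ[ℂ] R →ₗ[ℂ] R) (I : Submodule ℂ R) : Prop :=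
  IsIdeal br I ∧ ∃ k : ℕ, lowerCentralSeries br I k = ⊥

/-- `N` is the nilradical, i.e. the largest nilpotent ideal. -/
def IsNilradical (br : R →ₗ[ℂ] R →ₗ[ℂ] R) (N : Submodule ℂ R) : Prop :=
  IsGreatest {I : Submodule ℂ R | IsNilpotentIdeal br I} N

/-- Isomorphism of algebras. -/
def Isomorphic {S : Type*} [AddCommGroup S] [Module ℂ S]
    (brR : R →ₗ[ℂ] R →ₗ[ℂ] R) (brS : S →ₗ[ℂ] S →ₗ[ℂ] S) : Prop :=
  ∃ φ : R ≃ₗ[ℂ] S, ∀ a b : R, φ (brR a b) = brS (φ a) (φ b)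

/-- The family `R(G, s)`: `R` is a solvable Leibniz algebra `N ⊕ Q` whose nilradical `N` is,
as an algebra, isomorphic to `G`, and whose complementary space `Q` has dimension `s`. -/
def InFamily {G : Type*} [AddCommGroup G] [Module ℂ G]
    (brG : G →ₗ[ℂ] G →ₗ[ℂ] G) (s : ℕ) (brR : R →ₗ[ℂ] R →ₗ[ℂ] R) : Prop :=
  IsLeibniz brR ∧ IsSolvable brR ∧
    ∃ N Q : Submodule ℂ R, IsNilradical brR N ∧ IsCompl N Q ∧ Module.finrank ℂ Q = s ∧
      ∃ φ : G ≃ₗ[ℂ] N, ∀ a b : G, (φ (brG a b) : R) = brR (φ a) (φ b)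

end General

section Tables

/-- The symbol `e_k` in a multiplication table. -/
def e (k : ℕ) : ℕ → ℂ := Pi.single k 1

/-- The bilinear skew-symmetric bracket on `ℂ^m` with basis `e_1, …, e_m` given by a table
`T` that lists each nonzero product `[e_i, e_j] = T i j` in exactly one of the two orders (so
that `[e_i, e_j] = T i j - T j i`).  The basis vector `e_k` is the coordinate vector with
index `k - 1` in `Fin m`. -/
def ofTable (m : ℕ) (T : ℕ → ℕ → ℕ → ℂ) :
    (Fin m → ℂ) →ₗ[ℂ] (Fin m → ℂ) →ₗ[ℂ] (Fin m → ℂ) :=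
  LinearMap.mk₂ ℂ
    (fun v w k => ∑ i : Fin m, ∑ j : Fin m,
      v i * w j * (T (i + 1) (j + 1) (k + 1) - T (j + 1) (i + 1) (k + 1)))
    (by
      intro v v' w; ext k
      simp only [Pi.add_apply, ← Finset.sum_add_distrib, add_mul])
    (by
      intro c v w; ext k
      simp only [Pi.smul_apply, smul_eq_mul, Finset.mul_sum, mul_assoc])
    (by
      intro v w w'; ext k
      simp only [Pi.add_apply, ← Finset.sum_add_distrib, add_mul, mul_add])
    (by
      intro c v w; ext k
      simp only [Pi.smul_apply, smul_eq_mul, Finset.mul_sum]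
      refine Finset.sum_congr rfl fun i _ => Finset.sum_congr rfl fun j _ => ?_
      ring)

/-- `[e_1, e_i] = e_{i+1}` for `2 ≤ i ≤ n - 2`;
`[e_i, e_{n-i}] = (-1)^i e_n` for `2 ≤ i ≤ (n - 1) / 2`. -/
def tableG1 (n : ℕ) (i j : ℕ) : ℕ → ℂ :=
  if i = 1 ∧ 2 ≤ j ∧ j + 2 ≤ n then e (j + 1)
  else if 2 ≤ i ∧ 2 * i + 1 ≤ n ∧ i + j = n then (-1 : ℂ) ^ i • e n
  else 0

/-- `[e_1, e_i] = e_{i+1}` for `2 ≤ i ≤ n - 2`; `[e_i, e_n] = e_{i+2}` for `2 ≤ i ≤ n - 3`. -/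
def tableG2 (n : ℕ) (i j : ℕ) : ℕ → ℂ :=
  if i = 1 ∧ 2 ≤ j ∧ j + 2 ≤ n then e (j + 1)
  else if 2 ≤ i ∧ i + 3 ≤ n ∧ j = n then e (i + 2)
  else 0

/-- The table of `g²` together with `[e_2, e_i] = e_{i+3}` for `3 ≤ i ≤ n - 4`. -/
def tableG3 (n : ℕ) (i j : ℕ) : ℕ → ℂ :=
  if i = 1 ∧ 2 ≤ j ∧ j + 2 ≤ n then e (j + 1)
  else if 2 ≤ i ∧ i + 3 ≤ n ∧ j = n then e (i + 2)
  else if i = 2 ∧ 3 ≤ j ∧ j + 4 ≤ n then e (j + 3)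
  else 0

/-- `[e_1, e_i] = e_{i+1}`, `2 ≤ i ≤ 5`; `[e_2, e_i] = e_{i+2}`, `3 ≤ i ≤ 4`;
`[e_i, e_{7-i}] = (-1)^i e_7`, `2 ≤ i ≤ 3`. -/
def table7 (i j : ℕ) : ℕ → ℂ :=
  if i = 1 ∧ 2 ≤ j ∧ j ≤ 5 then e (j + 1)
  else if i = 2 ∧ 3 ≤ j ∧ j ≤ 4 then e (j + 2)
  else if 2 ≤ i ∧ i ≤ 3 ∧ i + j = 7 then (-1 : ℂ) ^ i • e 7
  else 0

/-- `[e_1, e_i] = e_{i+1}`, `2 ≤ i ≤ 7`; `[e_2, e_i] = e_{i+2}`, `3 ≤ i ≤ 4`;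
`[e_2, e_5] = 3 e_7`; `[e_2, e_6] = 5 e_8`; `[e_3, e_i] = -2 e_{i+3}`, `4 ≤ i ≤ 5`;
`[e_i, e_{9-i}] = (-1)^i e_9`, `2 ≤ i ≤ 4`. -/
def table9 (i j : ℕ) : ℕ → ℂ :=
  if i = 1 ∧ 2 ≤ j ∧ j ≤ 7 then e (j + 1)
  else if i = 2 ∧ 3 ≤ j ∧ j ≤ 4 then e (j + 2)
  else if i = 2 ∧ j = 5 then (3 : ℂ) • e 7
  else if i = 2 ∧ j = 6 then (5 : ℂ) • e 8
  else if i = 3 ∧ 4 ≤ j ∧ j ≤ 5 then (-2 : ℂ) • e (j + 3)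
  else if 2 ≤ i ∧ i ≤ 4 ∧ i + j = 9 then (-1 : ℂ) ^ i • e 9
  else 0

/-- `[e_1, e_i] = e_{i+1}`, `2 ≤ i ≤ 9`; `[e_2, e_i] = e_{i+2}`, `3 ≤ i ≤ 4`;
`[e_2, e_i] = -e_{i+2}`, `6 ≤ i ≤ 7`; `[e_3, e_7] = -e_10`;
`[e_3, e_i] = e_{i+3}`, `4 ≤ i ≤ 5`; `[e_4, e_i] = e_{i+4}`, `5 ≤ i ≤ 6`;
`[e_i, e_{11-i}] = (-1)^i e_11`, `2 ≤ i ≤ 5`. -/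
def table11 (i j : ℕ) : ℕ → ℂ :=
  if i = 1 ∧ 2 ≤ j ∧ j ≤ 9 then e (j + 1)
  else if i = 2 ∧ 3 ≤ j ∧ j ≤ 4 then e (j + 2)
  else if i = 2 ∧ 6 ≤ j ∧ j ≤ 7 then -e (j + 2)
  else if i = 3 ∧ j = 7 then -e 10
  else if i = 3 ∧ 4 ≤ j ∧ j ≤ 5 then e (j + 3)
  else if i = 4 ∧ 5 ≤ j ∧ j ≤ 6 then e (j + 4)
  else if 2 ≤ i ∧ i ≤ 5 ∧ i + j = 11 then (-1 : ℂ) ^ i • e 11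
  else 0

/-- The table of `R(g¹, 2)` in the basis `e_1, …, e_n, x = e_{n+1}, y = e_{n+2}`: that of `g¹`
together with `[e_1, x] = e_1`, `[e_i, x] = (i - 2) e_i` for `2 ≤ i ≤ n - 1`,
`[e_n, x] = (n - 4) e_n`, `[e_i, y] = e_i` for `2 ≤ i ≤ n - 1`, `[e_n, y] = 2 e_n`. -/
def tableR1 (n : ℕ) (i j : ℕ) : ℕ → ℂ :=
  if j = n + 1 then
    if i = 1 then e 1
    else if 2 ≤ i ∧ i + 1 ≤ n then ((i : ℂ) - 2) • e i
    else if i = n then ((n : ℂ) - 4) • e n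
    else 0
  else if j = n + 2 then
    if 2 ≤ i ∧ i + 1 ≤ n then e i
    else if i = n then (2 : ℂ) • e n
    else 0
  else tableG1 n i j

/-- The table of `R(g², 2)` in the basis `e_1, …, e_n, x = e_{n+1}, y = e_{n+2}`: that of `g²`
together with `[e_1, x] = e_1`, `[e_i, x] = (i - 2) e_i` for `2 ≤ i ≤ n - 1`,
`[e_n, x] = 2 e_n`, `[e_i, y] = e_i` for `2 ≤ i ≤ n - 1`. -/
def tableR2 (n : ℕ) (i j : ℕ) : ℕ → ℂ :=
  if j = n + 1 then
    if i = 1 then e 1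
    else if 2 ≤ i ∧ i + 1 ≤ n then ((i : ℂ) - 2) • e i
    else if i = n then (2 : ℂ) • e n
    else 0
  else if j = n + 2 then
    if 2 ≤ i ∧ i + 1 ≤ n then e i
    else 0
  else tableG2 n i j

/-- The nilradical algebras. -/
def g1 (n : ℕ) := ofTable n (tableG1 n)
def g2 (n : ℕ) := ofTable n (tableG2 n)
def g3 (n : ℕ) := ofTable n (tableG3 n)
def g7 := ofTable 7 table7
def g9 := ofTable 9 table9
def g11 := ofTable 11 table11

/-- The Lie algebras `R(g¹, 2)` and `R(g², 2)`. -/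
def R1 (n : ℕ) := ofTable (n + 2) (tableR1 n)
def R2 (n : ℕ) := ofTable (n + 2) (tableR2 n)

end Tables

end LeibnizAlg

/-! Each of the nilpotent algebras has a basis `f 1, …, f n` in which `[f i, f j]` is a multiple of
`f (i + j)`: the given basis for `g1` and the exceptional algebras, the order `e_1, e_n, e_2, …,
e_{n-1}` for `g2` and `g3`. A few nonzero products already force every derivation to be triangular
with respect to degree, with diagonal `a p + b q` for two fixed weight vectors `p`, `q`
(`filiform_rankTwo`, `shift_rankTwo`).

In an algebra of the family, right multiplications restrict to derivations of the nilradical, and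
reading off `(a, b)` gives a linear map to `ℂ²`. It kills brackets, since commutators of triangular
operators have zero diagonal, and its kernel is exactly the nilradical (`ker_weight`, by way of
`ker_eq_nilradical`). Hence the codimension is at most two. In the algebras of part (3) one further
nonzero product, `[f 2, f 3]` or `[f 3, f 4]`, makes `b` a fixed multiple of `a`, so the codimension
is at most one.

For `g1` and `g2`, codimension two makes the map to `ℂ²` onto. An element `t` of weight `(1, n)`
acts on the nilradical with distinct nonzero eigenvalues. Bijectivity of this action yields `x`, `y`
of weights `(1, 0)` and `(0, 1)` whose brackets with `t`, and then with each other, vanish.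
Injectivity also forces the bracket to be alternating, because central elements of the nilradical
lie in its derived algebra (`bracket_self_eq_zero`). Eigenvectors of `t` multiply by the original
structure constants, so they define an automorphism that makes `x` and `y` diagonal
(`exists_diagonalizing_automorphism`). The algebra is therefore the extension `torusExt` by `diag p`
and `diag q`, which is `R1` or `R2` in coordinates. -/

namespace LeibnizAlg

/-! ### Invariance of the notions under isomorphism. -/

section Transfer

variable {R S T : Type*} [AddCommGroup R] [Module ℂ R] [AddCommGroup S] [Module ℂ S]
  [AddCommGroup T] [Module ℂ T]
  {brR : R →ₗ[ℂ] R →ₗ[ℂ] R} {brS : S →ₗ[ℂ] S →ₗ[ℂ] S} {brT : T →ₗ[ℂ] T →ₗ[ℂ] T}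

theorem Isomorphic.symm (h : Isomorphic brR brS) : Isomorphic brS brR := by
  obtain ⟨φ, hφ⟩ := h
  refine ⟨φ.symm, fun a b => φ.injective ?_⟩
  simp [hφ]

theorem Isomorphic.trans (h : Isomorphic brR brS) (h' : Isomorphic brS brT) :
    Isomorphic brR brT := by
  obtain ⟨φ, hφ⟩ := h
  obtain ⟨ψ, hψ⟩ := h'
  exact ⟨φ.trans ψ, fun a b => by simp [hφ, hψ]⟩

theorem IsLie.skew (h : IsLie brR) (x y : R) : brR x y = -brR y x := by
  have h1 := h.1 (x + y)
  simp only [map_add, LinearMap.add_apply, h.1 x, h.1 y, zero_add, add_zero] at h1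
  exact eq_neg_of_add_eq_zero_right h1

theorem IsLie.isLeibniz (h : IsLie brR) : IsLeibniz brR := by
  intro x y z
  have h1 := h.2 x y z
  rw [h.skew y (brR z x), h.skew z (brR x y), h.skew z x, map_neg, LinearMap.neg_apply,
    neg_neg] at h1
  rw [← sub_eq_zero, ← h1]
  abel

theorem IsLie.congr (h : Isomorphic brR brS) (hR : IsLie brR) : IsLie brS := by
  obtain ⟨φ, hφ⟩ := h.symm
  refine ⟨fun x => φ.injective ?_, fun x y z => φ.injective ?_⟩
  · rw [hφ, hR.1, map_zero]
  · simp only [map_add, hφ, hR.2, map_zero]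

theorem IsLeibniz.congr (h : Isomorphic brR brS) (hR : IsLeibniz brR) : IsLeibniz brS := by
  obtain ⟨φ, hφ⟩ := h.symm
  refine fun x y z => φ.injective ?_
  rw [map_sub, hφ, hφ, hφ, hφ, hφ, hφ, hR]

theorem map_map₂_of_hom (φ : R ≃ₗ[ℂ] S) (hφ : ∀ a b, φ (brR a b) = brS (φ a) (φ b))
    (U V : Submodule ℂ R) :
    (Submodule.map₂ brR U V).map (φ : R →ₗ[ℂ] S) =
      Submodule.map₂ brS (U.map (φ : R →ₗ[ℂ] S)) (V.map (φ : R →ₗ[ℂ] S)) := by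
  apply le_antisymm
  · rw [Submodule.map_le_iff_le_comap, Submodule.map₂_le]
    intro u hu v hv
    rw [Submodule.mem_comap, LinearEquiv.coe_coe, hφ]
    exact Submodule.apply_mem_map₂ _ (Submodule.mem_map_of_mem hu) (Submodule.mem_map_of_mem hv)
  · rw [Submodule.map₂_le]
    rintro _ ⟨u, hu, rfl⟩ _ ⟨v, hv, rfl⟩
    exact ⟨brR u v, Submodule.apply_mem_map₂ _ hu hv, hφ u v⟩

theorem derivedSeries_map (φ : R ≃ₗ[ℂ] S) (hφ : ∀ a b, φ (brR a b) = brS (φ a) (φ b)) (k : ℕ) :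
    derivedSeries brS k = (derivedSeries brR k).map (φ : R →ₗ[ℂ] S) := by
  induction k with
  | zero => simp [derivedSeries]
  | succ k ih => rw [derivedSeries, derivedSeries, map_map₂_of_hom φ hφ, ih]

theorem lowerCentralSeries_map (φ : R ≃ₗ[ℂ] S) (hφ : ∀ a b, φ (brR a b) = brS (φ a) (φ b))
    (I : Submodule ℂ R) (k : ℕ) :
    lowerCentralSeries brS (I.map (φ : R →ₗ[ℂ] S)) k =
      (lowerCentralSeries brR I k).map (φ : R →ₗ[ℂ] S) := by
  induction k with
  | zero => rfl
  | succ k ih => rw [lowerCentralSeries, lowerCentralSeries, map_map₂_of_hom φ hφ, ih]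

theorem IsSolvable.congr (h : Isomorphic brR brS) (hR : IsSolvable brR) : IsSolvable brS := by
  obtain ⟨φ, hφ⟩ := h
  obtain ⟨k, hk⟩ := hR
  exact ⟨k, by rw [derivedSeries_map φ hφ, hk, Submodule.map_bot]⟩

theorem IsNilpotentIdeal.map (φ : R ≃ₗ[ℂ] S) (hφ : ∀ a b, φ (brR a b) = brS (φ a) (φ b))
    {I : Submodule ℂ R} (hI : IsNilpotentIdeal brR I) :
    IsNilpotentIdeal brS (I.map (φ : R →ₗ[ℂ] S)) := by
  obtain ⟨hI, k, hk⟩ := hI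
  refine ⟨?_, k, by rw [lowerCentralSeries_map φ hφ, hk, Submodule.map_bot]⟩
  rintro _ ⟨x, hx, rfl⟩ y
  obtain ⟨y, rfl⟩ := φ.surjective y
  exact ⟨⟨_, (hI x hx y).1, hφ x y⟩, ⟨_, (hI x hx y).2, hφ y x⟩⟩

theorem IsNilradical.map (φ : R ≃ₗ[ℂ] S) (hφ : ∀ a b, φ (brR a b) = brS (φ a) (φ b))
    {N : Submodule ℂ R} (hN : IsNilradical brR N) :
    IsNilradical brS (N.map (φ : R →ₗ[ℂ] S)) := by
  refine ⟨hN.1.map φ hφ, fun J hJ => ?_⟩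
  have h := hN.2 (IsNilpotentIdeal.map φ.symm (fun a b => φ.injective (by simp [hφ])) hJ)
  intro y hy
  exact ⟨φ.symm y, h ⟨y, hy, rfl⟩, by simp⟩

theorem InFamily.congr {G : Type*} [AddCommGroup G] [Module ℂ G] {brG : G →ₗ[ℂ] G →ₗ[ℂ] G}
    {s : ℕ} (h : Isomorphic brR brS) (hR : InFamily brG s brR) : InFamily brG s brS := by
  obtain ⟨hL, hs, N, Q, hN, hNQ, hQ, ψ, hψ⟩ := hR
  refine ⟨hL.congr h, hs.congr h, ?_⟩
  obtain ⟨φ, hφ⟩ := h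
  refine ⟨N.map (φ : R →ₗ[ℂ] S), Q.map (φ : R →ₗ[ℂ] S), hN.map φ hφ, ?_, ?_,
    ψ.trans (φ.submoduleMap N), ?_⟩
  · exact hNQ.map (Submodule.orderIsoMapComap φ)
  · rw [← hQ]
    exact (φ.submoduleMap Q).finrank_eq.symm
  · intro a b
    simp [hψ, hφ]

end Transfer

/-! ### Graded bases, triangular operators and their diagonalization. -/

section Graded

variable {G : Type*} [AddCommGroup G] [Module ℂ G]

/-- A basis `f 1, …, f n` of an algebra, with dual basis `ξ`, such that
`[f i, f j] = c i j • f (i + j)`. -/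
structure Graded (n : ℕ) (c : ℕ → ℕ → ℂ) (br : G →ₗ[ℂ] G →ₗ[ℂ] G) where
  f : ℕ → G
  ξ : ℕ → G →ₗ[ℂ] ℂ
  f_eq_zero : ∀ i, n < i → f i = 0
  ξ_f : ∀ i j, 1 ≤ i → i ≤ n → ξ i (f j) = if i = j then 1 else 0
  expand : ∀ v, v = ∑ i ∈ Finset.Icc 1 n, ξ i v • f i
  br_f : ∀ i j, 1 ≤ i → 1 ≤ j → br (f i) (f j) = c i j • f (i + j)

namespace Graded

variable {n : ℕ} {c : ℕ → ℕ → ℂ} {br : G →ₗ[ℂ] G →ₗ[ℂ] G} (S : Graded n c br)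

/-- The filtration by degree. -/
def F (k : ℕ) : Submodule ℂ G := Submodule.span ℂ (S.f '' {i | 1 ≤ i ∧ k ≤ i})

theorem f_mem {i k : ℕ} (hi : 1 ≤ i) (hk : k ≤ i) : S.f i ∈ S.F k :=
  Submodule.subset_span ⟨i, ⟨hi, hk⟩, rfl⟩

theorem F_anti {k l : ℕ} (h : k ≤ l) : S.F l ≤ S.F k :=
  Submodule.span_mono (Set.image_mono fun _ hi => ⟨hi.1, h.trans hi.2⟩)

theorem F_eq_top {k : ℕ} (h : k ≤ 1) : S.F k = ⊤ := by
  rw [eq_top_iff]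
  intro v _
  rw [S.expand v]
  exact Submodule.sum_mem _ fun i hi => Submodule.smul_mem _ _
    (S.f_mem (Finset.mem_Icc.1 hi).1 (h.trans (Finset.mem_Icc.1 hi).1))

theorem mem_F_one (v : G) : v ∈ S.F 1 := by simp [S.F_eq_top le_rfl]

theorem F_eq_bot {k : ℕ} (h : n < k) : S.F k = ⊥ := by
  rw [F, Submodule.span_eq_bot]
  rintro _ ⟨i, hi, rfl⟩
  exact S.f_eq_zero i (h.trans_le hi.2)

theorem ξ_self {i : ℕ} (h1 : 1 ≤ i) (hn : i ≤ n) : S.ξ i (S.f i) = 1 := by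
  simp [S.ξ_f i i h1 hn]

theorem ξ_of_ne {i j : ℕ} (h1 : 1 ≤ i) (hn : i ≤ n) (h : i ≠ j) : S.ξ i (S.f j) = 0 := by
  simp [S.ξ_f i j h1 hn, h]

theorem ξ_of_mem {i k : ℕ} {v : G} (hv : v ∈ S.F k) (h1 : 1 ≤ i) (hn : i ≤ n) (hk : i < k) :
    S.ξ i v = 0 := by
  have : S.F k ≤ LinearMap.ker (S.ξ i) := by
    rw [F, Submodule.span_le]
    rintro _ ⟨j, hj, rfl⟩
    exact S.ξ_of_ne h1 hn (by have := hj.2; omega)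
  exact this hv

theorem eq_zero_of_smul_f_mem {i k : ℕ} {s : ℂ} (h1 : 1 ≤ i) (hn : i ≤ n) (hk : i < k)
    (h : s • S.f i ∈ S.F k) : s = 0 := by
  simpa [S.ξ_self h1 hn] using S.ξ_of_mem h h1 hn hk

theorem sub_mem {k : ℕ} {v : G} (hk : 1 ≤ k) (hv : v ∈ S.F k) :
    v - S.ξ k v • S.f k ∈ S.F (k + 1) := by
  rcases lt_or_ge n k with h | h
  · rw [S.F_eq_bot h, Submodule.mem_bot] at hv
    simp [hv]
  have : S.F k ≤ (S.F (k + 1)).comap (LinearMap.id - (S.ξ k).smulRight (S.f k)) := by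
    rw [F, Submodule.span_le]
    rintro _ ⟨j, hj, rfl⟩
    rcases eq_or_ne k j with rfl | hne
    · simp [S.ξ_self hk h]
    · simpa [S.ξ_of_ne hk h hne] using S.f_mem hj.1 (by have := hj.2; omega)
  simpa using this hv

theorem mem_succ {k : ℕ} {v : G} (hk : 1 ≤ k) (hv : v ∈ S.F k) (h : S.ξ k v = 0) :
    v ∈ S.F (k + 1) := by
  simpa [h] using S.sub_mem hk hv

theorem hom_ext {M : Type*} [AddCommGroup M] [Module ℂ M] {A B : G →ₗ[ℂ] M}
    (h : ∀ i, 1 ≤ i → i ≤ n → A (S.f i) = B (S.f i)) : A = B := by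
  ext v
  rw [S.expand v, map_sum, map_sum]
  refine Finset.sum_congr rfl fun i hi => ?_
  rw [map_smul, map_smul, h i (Finset.mem_Icc.1 hi).1 (Finset.mem_Icc.1 hi).2]

theorem hom_ext₂ {M : Type*} [AddCommGroup M] [Module ℂ M] {A B : G →ₗ[ℂ] G →ₗ[ℂ] M}
    (h : ∀ i j, 1 ≤ i → i ≤ n → 1 ≤ j → j ≤ n → A (S.f i) (S.f j) = B (S.f i) (S.f j)) :
    A = B :=
  S.hom_ext fun i hi hi' => S.hom_ext fun j hj hj' => h i j hi hi' hj hj'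

theorem br_mem {i j : ℕ} {u v : G} (hu : u ∈ S.F i) (hv : v ∈ S.F j) :
    br u v ∈ S.F (i + j) := by
  have : Submodule.map₂ br (S.F i) (S.F j) ≤ S.F (i + j) := by
    rw [F, F, Submodule.map₂_span_span, Submodule.span_le]
    rintro _ ⟨_, ⟨i', hi, rfl⟩, _, ⟨j', hj, rfl⟩, rfl⟩
    simp only [SetLike.mem_coe]
    rw [S.br_f _ _ hi.1 hj.1]
    exact Submodule.smul_mem _ _ (S.f_mem (by have := hi.1; omega) (add_le_add hi.2 hj.2))
  exact this (Submodule.apply_mem_map₂ _ hu hv)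

/-- Only the product of the two leading terms can have degree `i + j`; every error term contains a
factor of higher degree. -/
theorem br_lead {i j : ℕ} {u v : G} {s t : ℂ} (hi : 1 ≤ i) (hj : 1 ≤ j)
    (hu : u - s • S.f i ∈ S.F (i + 1)) (hv : v - t • S.f j ∈ S.F (j + 1)) :
    br u v - (s * t * c i j) • S.f (i + j) ∈ S.F (i + j + 1) := by
  have e : br u v - (s * t * c i j) • S.f (i + j) =
      br (u - s • S.f i) (t • S.f j) + br (s • S.f i) (v - t • S.f j)
        + br (u - s • S.f i) (v - t • S.f j) := by
    simp only [map_sub, map_smul, LinearMap.sub_apply, LinearMap.smul_apply, S.br_f i j hi hj]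
    module
  rw [e]
  refine add_mem (add_mem ?_ ?_) ?_
  · exact S.F_anti (by omega) (S.br_mem hu (Submodule.smul_mem _ _ (S.f_mem hj le_rfl)))
  · exact S.F_anti (by omega) (S.br_mem (Submodule.smul_mem _ _ (S.f_mem hi le_rfl)) hv)
  · exact S.F_anti (by omega) (S.br_mem hu hv)

/-- `D` is triangular with diagonal `d`. -/
def Tri (D : G →ₗ[ℂ] G) (d : ℕ → ℂ) : Prop :=
  ∀ i, 1 ≤ i → i ≤ n → D (S.f i) - d i • S.f i ∈ S.F (i + 1)

variable {S} {D D' : G →ₗ[ℂ] G} {d d' : ℕ → ℂ}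

theorem Tri.map_f_mem (h : S.Tri D d) {i : ℕ} (hi : 1 ≤ i) : D (S.f i) ∈ S.F i := by
  rcases lt_or_ge n i with hn | hn
  · simp [S.f_eq_zero i hn]
  · simpa using add_mem (S.F_anti (Nat.le_succ i) (h i hi hn))
      (Submodule.smul_mem _ (d i) (S.f_mem hi le_rfl))

theorem Tri.map_mem (h : S.Tri D d) {k : ℕ} {v : G} (hv : v ∈ S.F k) : D v ∈ S.F k := by
  have : S.F k ≤ (S.F k).comap D := by
    rw [F, Submodule.span_le]
    rintro _ ⟨j, hj, rfl⟩
    exact S.F_anti hj.2 (h.map_f_mem hj.1)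
  exact this hv

theorem Tri.map_mem_succ (h : S.Tri D d) (hd : ∀ i, 1 ≤ i → i ≤ n → d i = 0) {k : ℕ} {v : G}
    (hv : v ∈ S.F k) : D v ∈ S.F (k + 1) := by
  have : S.F k ≤ (S.F (k + 1)).comap D := by
    rw [F, Submodule.span_le]
    rintro _ ⟨j, hj, rfl⟩
    rcases lt_or_ge n j with hn | hn
    · simp [S.f_eq_zero j hn]
    · have := h j hj.1 hn
      rw [hd j hj.1 hn, zero_smul, sub_zero] at this
      exact S.F_anti (by have := hj.2; omega) this
  exact this hv

theorem Tri.ξ_map (h : S.Tri D d) {k : ℕ} {v : G} (hk : 1 ≤ k) (hn : k ≤ n) (hv : v ∈ S.F k) :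
    S.ξ k (D v) = d k * S.ξ k v := by
  have h1 := S.ξ_of_mem (h.map_mem (S.sub_mem hk hv)) hk hn (Nat.lt_succ_self k)
  have h2 := S.ξ_of_mem (h k hk hn) hk hn (Nat.lt_succ_self k)
  simp only [map_sub, map_smul, smul_eq_mul, S.ξ_self hk hn] at h1 h2
  linear_combination h1 + S.ξ k v * h2

theorem Tri.ξ_f (h : S.Tri D d) {k : ℕ} (hk : 1 ≤ k) (hn : k ≤ n) :
    S.ξ k (D (S.f k)) = d k := by
  rw [h.ξ_map hk hn (S.f_mem hk le_rfl), S.ξ_self hk hn, mul_one]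

/-- Comparing coefficients in the lowest degree `i` of an eigenvector shows that its eigenvalue is
`d i`. If no such entry is available from degree `k` on, the coefficients vanish degree by degree.
-/
theorem Tri.eq_zero_of_eigen (h : S.Tri D d) {k : ℕ} {v : G} {l : ℂ} (hk : 1 ≤ k)
    (hl : ∀ i, k ≤ i → i ≤ n → d i ≠ l) (hv : v ∈ S.F k) (hD : D v = l • v) : v = 0 := by
  have key : ∀ m, v ∈ S.F (k + m) := by
    intro m
    induction m with
    | zero => exact hv
    | succ m ih =>
      rcases lt_or_ge n (k + m) with hn | hn
      · rw [S.F_eq_bot hn, Submodule.mem_bot] at ih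
        simp [ih]
      · refine S.mem_succ (k := k + m) (by omega) ih ?_
        have h1 := h.ξ_map (k := k + m) (by omega) hn ih
        rw [hD, map_smul, smul_eq_mul] at h1
        have h2 : (d (k + m) - l) * S.ξ (k + m) v = 0 := by linear_combination -h1
        exact (mul_eq_zero.1 h2).resolve_left (sub_ne_zero.2 (hl _ (by omega) hn))
  have := key (n + 1)
  rwa [S.F_eq_bot (by omega), Submodule.mem_bot] at this

theorem Tri.injective (h : S.Tri D d) (hd : ∀ i, 1 ≤ i → i ≤ n → d i ≠ 0) :
    Function.Injective D := by
  rw [injective_iff_map_eq_zero]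
  intro v hv
  exact h.eq_zero_of_eigen le_rfl hd (S.mem_F_one v) (l := 0) (by simpa using hv)

theorem finiteDimensional (S : Graded n c br) : FiniteDimensional ℂ G := by
  have h : (Submodule.span ℂ (S.f '' (Finset.Icc 1 n : Finset ℕ))).FG :=
    Submodule.fg_span ((Finset.finite_toSet _).image _)
  have e : Submodule.span ℂ (S.f '' (Finset.Icc 1 n : Finset ℕ)) = ⊤ := by
    rw [eq_top_iff]
    intro v _
    rw [S.expand v]
    exact Submodule.sum_mem _ fun i hi => Submodule.smul_mem _ _
      (Submodule.subset_span ⟨i, hi, rfl⟩)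
  exact ⟨e ▸ h⟩

/-- `D - d i` is injective on `F (i + 1)`, hence surjective there by finite dimension, so the error
`D (f i) - d i • f i` can be removed by a correction of higher degree. -/
theorem Tri.exists_eigenvector (h : S.Tri D d) {i : ℕ} (hi : 1 ≤ i) (hn : i ≤ n)
    (hd : ∀ k, i < k → k ≤ n → d k ≠ d i) :
    ∃ v, v - S.f i ∈ S.F (i + 1) ∧ D v = d i • v := by
  have := S.finiteDimensional
  let E : S.F (i + 1) →ₗ[ℂ] S.F (i + 1) := (D - d i • LinearMap.id).restrict (by
    intro v hv
    simp only [LinearMap.sub_apply, LinearMap.smul_apply, LinearMap.id_apply]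
    exact Submodule.sub_mem _ (h.map_mem hv) (Submodule.smul_mem _ _ hv))
  have hE : Function.Injective E := by
    rw [injective_iff_map_eq_zero]
    rintro ⟨v, hv⟩ h0
    have h0 : D v - d i • v = 0 := by simpa [E] using congrArg Subtype.val h0
    exact Subtype.ext (h.eq_zero_of_eigen (by omega) (fun k hk => hd k (by omega)) hv
      (sub_eq_zero.1 h0))
  obtain ⟨⟨w, hw⟩, hEw⟩ := LinearMap.surjective_of_injective hE ⟨_, h i hi hn⟩
  have hEw : D w - d i • w = D (S.f i) - d i • S.f i := by
    simpa [E] using congrArg Subtype.val hEw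
  refine ⟨S.f i - w, by simpa using hw, ?_⟩
  rw [map_sub, smul_sub]
  rw [sub_eq_sub_iff_add_eq_add] at hEw
  rw [sub_eq_sub_iff_add_eq_add, ← hEw, add_comm]

/-- The linear map sending `f i` to `v i`. -/
def lift {M : Type*} [AddCommGroup M] [Module ℂ M] (S : Graded n c br) (v : ℕ → M) : G →ₗ[ℂ] M :=
  ∑ i ∈ Finset.Icc 1 n, (S.ξ i).smulRight (v i)

theorem lift_f {M : Type*} [AddCommGroup M] [Module ℂ M] (S : Graded n c br) (v : ℕ → M)
    {i : ℕ} (hi : 1 ≤ i) (hn : i ≤ n) : S.lift v (S.f i) = v i := by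
  rw [lift, LinearMap.sum_apply, Finset.sum_eq_single i]
  · simp [S.ξ_self hi hn]
  · intro j hj hne
    simp [S.ξ_of_ne (Finset.mem_Icc.1 hj).1 (Finset.mem_Icc.1 hj).2 hne]
  · simp [hi, hn]

/-- The diagonal operator with eigenvalue `p i` on `f i`. -/
def diag (S : Graded n c br) (p : ℕ → ℂ) : G →ₗ[ℂ] G := S.lift fun i => p i • S.f i

theorem diag_f (S : Graded n c br) (p : ℕ → ℂ) {i : ℕ} (hi : 1 ≤ i) :
    S.diag p (S.f i) = p i • S.f i := by
  rcases lt_or_ge n i with hn | hn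
  · simp [S.f_eq_zero i hn]
  · exact S.lift_f _ hi hn

theorem tri_diag (S : Graded n c br) (p : ℕ → ℂ) : S.Tri (S.diag p) p := by
  intro i hi _
  simp [S.diag_f p hi]

/-- The weights `d` are additive along the nonzero structure constants. -/
def WeightAdditive (n : ℕ) (c : ℕ → ℕ → ℂ) (d : ℕ → ℂ) : Prop :=
  ∀ i j, 1 ≤ i → 1 ≤ j → i + j ≤ n → c i j ≠ 0 → d (i + j) = d i + d j

/-- Sums of weights are not weights in degrees where the bracket vanishes. -/
def WeightGeneric (n : ℕ) (c : ℕ → ℕ → ℂ) (d : ℕ → ℂ) : Prop :=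
  ∀ i j k, 1 ≤ i → 1 ≤ j → c i j = 0 → i + j < k → k ≤ n → d k ≠ d i + d j

theorem diag_br (S : Graded n c br) {p : ℕ → ℂ} (hp : WeightAdditive n c p) (u v : G) :
    S.diag p (br u v) = br (S.diag p u) v + br u (S.diag p v) := by
  have : br.compr₂ (S.diag p) = br.comp (S.diag p) + br.compl₂ (S.diag p) := by
    refine S.hom_ext₂ fun i j hi hi' hj hj' => ?_
    simp only [LinearMap.compr₂_apply, LinearMap.add_apply, LinearMap.comp_apply,
      LinearMap.compl₂_apply, S.diag_f p hi, S.diag_f p hj, map_smul, LinearMap.smul_apply,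
      S.br_f i j hi hj, S.diag_f p (show 1 ≤ i + j by omega)]
    rcases lt_or_ge n (i + j) with hn | hn
    · simp [S.f_eq_zero _ hn]
    by_cases hc : c i j = 0
    · simp [hc]
    · rw [hp i j hi hj hn hc]
      module
  simpa using LinearMap.congr_fun₂ this u v

theorem diag_comm (S : Graded n c br) (p q : ℕ → ℂ) (u : G) :
    S.diag p (S.diag q u) = S.diag q (S.diag p u) := by
  have : (S.diag p).comp (S.diag q) = (S.diag q).comp (S.diag p) := by
    refine S.hom_ext fun i hi _ => ?_
    simp only [LinearMap.comp_apply, S.diag_f _ hi, map_smul]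
    rw [smul_comm]
  exact LinearMap.congr_fun this u

/-- `θ` sends `f i` to the eigenvector `v i` with leading term `f i`. The bracket of `v i` and `v j`
has eigenvalue `d i + d j`, and its difference from `c i j • v (i + j)` lies in `F (i + j + 1)`,
where that eigenvalue does not occur: by `hgen` if `c i j = 0`, by `hadd` and `hinj` otherwise. An
operator commuting with `D` preserves its one-dimensional eigenspaces, so it is diagonal in the same
basis. -/
theorem exists_diagonalizing_automorphism (S : Graded n c br)
    (hD : ∀ u v, D (br u v) = br (D u) v + br u (D v)) (h : S.Tri D d)
    (hinj : ∀ i k, 1 ≤ i → i < k → k ≤ n → d k ≠ d i)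
    (hadd : WeightAdditive n c d) (hgen : WeightGeneric n c d) :
    ∃ θ : G ≃ₗ[ℂ] G, (∀ u v, θ (br u v) = br (θ u) (θ v)) ∧
      ∀ (D' : G →ₗ[ℂ] G) (d' : ℕ → ℂ), S.Tri D' d' → (∀ u, D (D' u) = D' (D u)) →
        ∀ u, D' (θ u) = θ (S.diag d' u) := by
  have hex : ∀ i, ∃ v, 1 ≤ i → v - S.f i ∈ S.F (i + 1) ∧ D v = d i • v := by
    intro i
    by_cases hi : 1 ≤ i ∧ i ≤ n
    · obtain ⟨v, hv⟩ := h.exists_eigenvector hi.1 hi.2 (fun k => hinj i k hi.1)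
      exact ⟨v, fun _ => hv⟩
    · refine ⟨0, fun h1 => ?_⟩
      rw [S.f_eq_zero i (by omega)]
      simp
  choose v hv using hex
  have hv0 : ∀ i, n < i → v i = 0 := by
    intro i hi
    have := (hv i (by omega)).1
    rwa [S.f_eq_zero i hi, S.F_eq_bot (by omega), Submodule.mem_bot, sub_zero] at this
  have hθ : ∀ i, 1 ≤ i → S.lift v (S.f i) = v i := by
    intro i hi
    rcases lt_or_ge n i with hn | hn
    · simp [S.f_eq_zero i hn, hv0 i hn]
    · exact S.lift_f v hi hn
  have htri : S.Tri (S.lift v) (fun _ => 1) := by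
    intro i hi _
    rw [hθ i hi, one_smul]
    exact (hv i hi).1
  have hθi : Function.Injective (S.lift v) := htri.injective (by simp)
  have := S.finiteDimensional
  refine ⟨LinearEquiv.ofInjectiveEndo _ hθi, ?_, ?_⟩
  · intro a b
    have : br.compr₂ (S.lift v) = br.compl₁₂ (S.lift v) (S.lift v) := by
      refine S.hom_ext₂ fun i j hi hi' hj hj' => ?_
      simp only [LinearMap.compr₂_apply, LinearMap.compl₁₂_apply, hθ i hi, hθ j hj,
        S.br_f i j hi hj, map_smul, hθ (i + j) (by omega)]
      have h1 : D (br (v i) (v j)) = (d i + d j) • br (v i) (v j) := by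
        rw [hD, (hv i hi).2, (hv j hj).2, map_smul, map_smul, LinearMap.smul_apply, add_smul]
      have h2 := S.br_lead (s := 1) (t := 1) hi hj (by simpa using (hv i hi).1)
        (by simpa using (hv j hj).1)
      rw [one_mul, one_mul] at h2
      by_cases hc : c i j = 0
      · rw [hc, zero_smul, sub_zero] at h2
        rw [hc, zero_smul]
        exact (h.eq_zero_of_eigen (by omega)
          (fun k hk => hgen i j k hi hj hc (by omega)) h2 h1).symm
      · rcases lt_or_ge n (i + j) with hn | hn
        · rw [S.f_eq_zero _ hn, smul_zero, sub_zero, S.F_eq_bot (by omega),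
            Submodule.mem_bot] at h2
          rw [h2, hv0 _ hn, smul_zero]
        · rw [eq_comm, ← sub_eq_zero]
          refine h.eq_zero_of_eigen (k := i + j + 1) (l := d (i + j)) (by omega)
            (fun k hk => hinj (i + j) k (by omega) (by omega)) ?_ ?_
          · have h3 := Submodule.sub_mem _ h2
              (Submodule.smul_mem _ (c i j) (hv (i + j) (by omega)).1)
            convert h3 using 1
            module
          · rw [map_sub, map_smul, h1, (hv (i + j) (by omega)).2, hadd i j hi hj hn hc]
            module
    simpa using LinearMap.congr_fun₂ this a b
  · intro D' d' h' hcomm u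
    have : D'.comp (S.lift v) = (S.lift v).comp (S.diag d') := by
      refine S.hom_ext fun i hi hn => ?_
      simp only [LinearMap.comp_apply, S.diag_f d' hi, map_smul, hθ i hi]
      rw [← sub_eq_zero]
      refine h.eq_zero_of_eigen (k := i + 1) (l := d i) (by omega)
            (fun k hk => hinj i k hi (by omega)) ?_ ?_
      · have h3 := add_mem (h'.map_mem (hv i hi).1) (Submodule.sub_mem _ (h' i hi hn)
          (Submodule.smul_mem _ (d' i) (hv i hi).1))
        convert h3 using 1
        rw [map_sub]
        module
      · rw [map_sub, hcomm, (hv i hi).2, map_smul, map_smul, (hv i hi).2]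
        module
    simpa using LinearMap.congr_fun this u

end Graded

end Graded

/-! ### The action of a solvable Leibniz algebra on its nilradical. -/

section Action

variable {R G W : Type*} [AddCommGroup R] [Module ℂ R] [AddCommGroup G] [Module ℂ G]
  [AddCommGroup W] [Module ℂ W]
  {br : R →ₗ[ℂ] R →ₗ[ℂ] R} {brG : G →ₗ[ℂ] G →ₗ[ℂ] G}
  {ι : G →ₗ[ℂ] R} {D : R →ₗ[ℂ] G →ₗ[ℂ] G}

theorem derivedSeries_isIdeal (hL : IsLeibniz br) (k : ℕ) : IsIdeal br (derivedSeries br k) := by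
  induction k with
  | zero => intro x _ y; simp [derivedSeries]
  | succ k ih =>
    intro x hx y
    rw [derivedSeries] at hx ⊢
    set U := derivedSeries br k
    have h1 : Submodule.map₂ br U U ≤ (Submodule.map₂ br U U).comap (br.flip y) := by
      refine Submodule.map₂_le.2 fun a ha b hb => ?_
      have := hL a b y
      rw [eq_sub_iff_add_eq] at this
      rw [Submodule.mem_comap, LinearMap.flip_apply, ← this]
      exact add_mem (Submodule.apply_mem_map₂ _ ha (ih b hb y).1)
        (Submodule.apply_mem_map₂ _ (ih a ha y).1 hb)
    have h2 : Submodule.map₂ br U U ≤ (Submodule.map₂ br U U).comap (br y) := by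
      refine Submodule.map₂_le.2 fun a ha b hb => ?_
      rw [Submodule.mem_comap, hL]
      exact Submodule.sub_mem _ (Submodule.apply_mem_map₂ _ (ih a ha y).2 hb)
        (Submodule.apply_mem_map₂ _ (ih b hb y).2 ha)
    exact ⟨h1 hx, h2 hx⟩

theorem derivedSeries_succ_le (hL : IsLeibniz br) (k : ℕ) :
    derivedSeries br (k + 1) ≤ derivedSeries br k := by
  rw [derivedSeries, Submodule.map₂_le]
  intro a ha b _
  exact (derivedSeries_isIdeal hL k a ha b).1

theorem derivedSeries_le_of_le (hL : IsLeibniz br) {k l : ℕ} (h : k ≤ l) :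
    derivedSeries br l ≤ derivedSeries br k :=
  antitone_nat_of_succ_le (derivedSeries_succ_le hL) h

/-- If a linear map `χ` on a solvable algebra kills all brackets and the nilradical, and the
elements of its kernel act on the nilradical by strictly triangular operators, then its kernel
is the nilradical. -/
theorem ker_eq_nilradical (hL : IsLeibniz br) (hs : IsSolvable br)
    (hN : IsNilradical br (LinearMap.range ι)) (hD : ∀ r u, ι (D r u) = br (ι u) r)
    (Fil : ℕ → Submodule ℂ G) (h0 : Fil 0 = ⊤) {m : ℕ} (hm : Fil m = ⊥) (χ : R →ₗ[ℂ] W)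
    (hχ : ∀ r s, χ (br r s) = 0) (hχι : ∀ u, χ (ι u) = 0)
    (hstrict : ∀ r k u, χ r = 0 → u ∈ Fil k → D r u ∈ Fil (k + 1)) :
    LinearMap.ker χ = LinearMap.range ι := by
  -- Such an ideal is nilpotent: after one bracket its lower central series is inside the
  -- nilradical, and each further bracket with `I` raises the filtration. Maximality of the
  -- nilradical applies.
  have key : ∀ I : Submodule ℂ R, IsIdeal br I → I ≤ LinearMap.ker χ →
      Submodule.map₂ br I I ≤ LinearMap.range ι → I ≤ LinearMap.range ι := by
    intro I hI hIχ hII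
    have hl : ∀ k, lowerCentralSeries br I (k + 1) ≤ (Fil k).map ι := by
      intro k
      induction k with
      | zero => rw [h0, Submodule.map_top]; exact hII
      | succ k ih =>
        rw [lowerCentralSeries, Submodule.map₂_le]
        intro a ha b hb
        obtain ⟨u, hu, rfl⟩ := ih ha
        exact ⟨D b u, hstrict b k u (hIχ hb) hu, hD b u⟩
    refine hN.2 ⟨hI, m + 1, ?_⟩
    have := hl m
    rwa [hm, Submodule.map_bot, le_bot_iff] at this
  have hder1 : ∀ k, derivedSeries br (k + 1) ≤ LinearMap.ker χ := by
    intro k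
    refine (derivedSeries_le_of_le hL (Nat.succ_le_succ (Nat.zero_le k))).trans ?_
    rw [derivedSeries, Submodule.map₂_le]
    intro a _ b _
    exact hχ a b
  have hder : derivedSeries br 1 ≤ LinearMap.range ι := by
    obtain ⟨k, hk⟩ := hs
    -- Descending induction along the derived series: the square of each term is the next one,
    -- already known to lie in the nilradical.
    have : ∀ j i, i + j = k → derivedSeries br (i + 1) ≤ LinearMap.range ι := by
      intro j
      induction j with
      | zero =>
        rintro i rfl
        exact (derivedSeries_succ_le hL _).trans (by rw [add_zero] at hk; simp [hk])
      | succ j ih =>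
        intro i hi
        exact key _ (derivedSeries_isIdeal hL _) (hder1 i) (ih (i + 1) (by omega))
    exact this k 0 (zero_add k)
  apply le_antisymm
  -- The kernel contains all brackets, so it is an ideal, and its square lies in the derived
  -- algebra.
  · refine key _ (fun x _ y => ⟨hχ x y, hχ y x⟩) le_rfl (le_trans ?_ hder)
    rw [derivedSeries, Submodule.map₂_le]
    intro a _ b _
    exact Submodule.apply_mem_map₂ _ (by simp [derivedSeries]) (by simp [derivedSeries])
  · rintro _ ⟨u, rfl⟩
    exact hχι u

/-- Right multiplications preserve the nilradical, so they can be pulled back along `ι`. Composing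
with a linear left inverse of `ι` makes this pullback linear in both arguments. -/
theorem InFamily.exists_action {s : ℕ} (h : InFamily brG s br) :
    IsLeibniz br ∧ IsSolvable br ∧ ∃ (ι : G →ₗ[ℂ] R) (D : R →ₗ[ℂ] G →ₗ[ℂ] G)
      (Q : Submodule ℂ R),
      Function.Injective ι ∧ (∀ u v, ι (brG u v) = br (ι u) (ι v)) ∧
      (∀ r u, ι (D r u) = br (ι u) r) ∧ IsNilradical br (LinearMap.range ι) ∧
      IsCompl (LinearMap.range ι) Q ∧ Module.finrank ℂ Q = s := by
  obtain ⟨hL, hs, N, Q, hN, hNQ, hQ, φ, hφ⟩ := h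
  have hr : LinearMap.range (N.subtype ∘ₗ (φ : G →ₗ[ℂ] N)) = N := by
    rw [LinearMap.range_comp, LinearEquiv.range, Submodule.map_top, Submodule.range_subtype]
  have hinj : Function.Injective (N.subtype ∘ₗ (φ : G →ₗ[ℂ] N)) := by
    rw [LinearMap.coe_comp]
    exact N.injective_subtype.comp φ.injective
  refine ⟨hL, hs, N.subtype ∘ₗ (φ : G →ₗ[ℂ] N), ?_⟩
  obtain ⟨π, hπ⟩ := LinearMap.exists_leftInverse_of_injective _ (LinearMap.ker_eq_bot.2 hinj)
  refine ⟨(br.flip.compl₂ (N.subtype ∘ₗ (φ : G →ₗ[ℂ] N))).compr₂ π, Q, hinj, hφ, ?_,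
    by rwa [hr], by rwa [hr], hQ⟩
  intro r u
  have hmem : br ((N.subtype ∘ₗ (φ : G →ₗ[ℂ] N)) u) r ∈
      LinearMap.range (N.subtype ∘ₗ (φ : G →ₗ[ℂ] N)) := by
    rw [hr]
    exact (hN.1.1 _ (φ u).2 r).1
  obtain ⟨w, hw⟩ := hmem
  simp only [LinearMap.compr₂_apply, LinearMap.compl₂_apply, LinearMap.flip_apply]
  rw [← hw]
  congr 1
  exact LinearMap.congr_fun hπ w

/-- The right Leibniz identity is precisely the derivation rule for right multiplications. -/
theorem action_derivation (hL : IsLeibniz br) (hι : Function.Injective ι)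
    (hom : ∀ u v, ι (brG u v) = br (ι u) (ι v)) (hD : ∀ r u, ι (D r u) = br (ι u) r)
    (r : R) (u v : G) : D r (brG u v) = brG (D r u) v + brG u (D r v) := by
  apply hι
  rw [map_add, hD, hom, hom, hom, hD, hD, hL]
  abel

theorem action_br (hL : IsLeibniz br) (hι : Function.Injective ι)
    (hD : ∀ r u, ι (D r u) = br (ι u) r)
    (r s : R) (u : G) : D (br r s) u = D s (D r u) - D r (D s u) := by
  apply hι
  rw [map_sub, hD, hD, hD, hD, hD, hL]

theorem action_inner (hι : Function.Injective ι)
    (hom : ∀ u v, ι (brG u v) = br (ι u) (ι v)) (hD : ∀ r u, ι (D r u) = br (ι u) r)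
    (u v : G) : D (ι v) u = brG u v := by
  apply hι
  rw [hD, hom]

end Action

/-! ### The weight map and its kernel. -/

namespace Graded

variable {R G : Type*} [AddCommGroup R] [Module ℂ R] [AddCommGroup G] [Module ℂ G]
  {br : R →ₗ[ℂ] R →ₗ[ℂ] R} {brG : G →ₗ[ℂ] G →ₗ[ℂ] G}
  {ι : G →ₗ[ℂ] R} {D : R →ₗ[ℂ] G →ₗ[ℂ] G}
  {n : ℕ} {c : ℕ → ℕ → ℂ} {S : Graded n c brG} {g : ℕ} {p q : ℕ → ℂ}

/-- All derivations are triangular, with diagonals spanned by `p` and `q`. -/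
def RankTwo (S : Graded n c brG) (g : ℕ) (p q : ℕ → ℂ) : Prop :=
  ∀ D : G →ₗ[ℂ] G, (∀ u v, D (brG u v) = brG (D u) v + brG u (D v)) →
    S.Tri D (fun i => S.ξ 1 (D (S.f 1)) * p i + S.ξ g (D (S.f g)) * q i)

/-- The two diagonal entries that determine the diagonal of the action of an element. -/
def weight (S : Graded n c brG) (g : ℕ) (D : R →ₗ[ℂ] G →ₗ[ℂ] G) : R →ₗ[ℂ] ℂ × ℂ :=
  ((S.ξ 1).comp (D.flip (S.f 1))).prod ((S.ξ g).comp (D.flip (S.f g)))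

theorem weight_apply (r : R) :
    S.weight g D r = (S.ξ 1 (D r (S.f 1)), S.ξ g (D r (S.f g))) := rfl

theorem RankTwo.tri (h : S.RankTwo g p q) (hL : IsLeibniz br) (hι : Function.Injective ι)
    (hom : ∀ u v, ι (brG u v) = br (ι u) (ι v)) (hD : ∀ r u, ι (D r u) = br (ι u) r) (r : R) :
    S.Tri (D r) (fun i => (S.weight g D r).1 * p i + (S.weight g D r).2 * q i) :=
  h (D r) (action_derivation hL hι hom hD r)

/-- A bracket acts by a commutator of triangular operators, whose diagonal is zero. An element of
the nilradical acts by a bracket with an element of `F 1`, which raises degree. Elements of weight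
zero act strictly triangularly, as `ker_eq_nilradical` requires. -/
theorem RankTwo.ker_weight (h : S.RankTwo g p q) (hn : 1 ≤ n) (hg1 : 1 ≤ g) (hgn : g ≤ n)
    (hL : IsLeibniz br) (hs : IsSolvable br) (hN : IsNilradical br (LinearMap.range ι))
    (hι : Function.Injective ι) (hom : ∀ u v, ι (brG u v) = br (ι u) (ι v))
    (hD : ∀ r u, ι (D r u) = br (ι u) r) :
    (∀ r s, S.weight g D (br r s) = 0) ∧ LinearMap.ker (S.weight g D) = LinearMap.range ι := by
  have htri := h.tri hL hι hom hD
  have hbr : ∀ r s, S.weight g D (br r s) = 0 := by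
    intro r s
    have key : ∀ i, 1 ≤ i → i ≤ n → S.ξ i (D (br r s) (S.f i)) = 0 := by
      intro i hi hin
      rw [action_br hL hι hD, map_sub, (htri s).ξ_map hi hin ((htri r).map_f_mem hi),
        (htri r).ξ_map hi hin ((htri s).map_f_mem hi), (htri r).ξ_f hi hin, (htri s).ξ_f hi hin]
      ring
    rw [weight_apply, key 1 le_rfl hn, key g hg1 hgn]
    rfl
  refine ⟨hbr, ker_eq_nilradical hL hs hN hD (fun k => S.F (k + 1)) (S.F_eq_top le_rfl) (m := n)
    (S.F_eq_bot (Nat.lt_succ_self n)) _ hbr ?_ ?_⟩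
  · intro u
    have key : ∀ i, 1 ≤ i → i ≤ n → S.ξ i (D (ι u) (S.f i)) = 0 := by
      intro i hi hin
      rw [action_inner hι hom hD]
      exact S.ξ_of_mem (S.br_mem (S.f_mem hi le_rfl) (S.mem_F_one u)) hi hin
        (Nat.lt_succ_self i)
    rw [weight_apply, key 1 le_rfl hn, key g hg1 hgn]
    rfl
  · intro r k u hr hu
    refine (htri r).map_mem_succ ?_ hu
    intro i _ _
    simp [hr]

/-- If the two weights are proportional, then the nilradical has codimension at most one. -/
theorem RankTwo.not_inFamily_of_proportional (h : S.RankTwo g p q) (hn : 1 ≤ n) (hg1 : 1 ≤ g)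
    (hgn : g ≤ n) (κ : ℂ)
    (hκ : ∀ D : G →ₗ[ℂ] G, (∀ u v, D (brG u v) = brG (D u) v + brG u (D v)) →
      S.ξ g (D (S.f g)) = κ * S.ξ 1 (D (S.f 1))) : ¬ InFamily brG 2 br := by
  intro hF
  obtain ⟨hL, hs, ι, D, Q, hι, hom, hD, hN, hNQ, hQ⟩ := hF.exists_action
  have hker := (h.ker_weight hn hg1 hgn hL hs hN hι hom hD).2
  -- The first weight determines the second, so it alone is injective on the complement, which would
  -- embed a plane into a line.
  have hinj : Function.Injective ((LinearMap.fst ℂ ℂ ℂ ∘ₗ S.weight g D) ∘ₗ Q.subtype) := by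
    rw [injective_iff_map_eq_zero]
    rintro ⟨r, hr⟩ h0
    have h0 : S.ξ 1 (D r (S.f 1)) = 0 := h0
    have h1 : r ∈ LinearMap.ker (S.weight g D) := by
      rw [LinearMap.mem_ker, weight_apply, hκ _ (action_derivation hL hι hom hD r), h0, mul_zero]
      rfl
    rw [hker] at h1
    exact Subtype.ext ((Submodule.disjoint_def.1 hNQ.disjoint) r h1 hr)
  have := LinearMap.finrank_le_finrank_of_injective hinj
  rw [hQ, Module.finrank_self] at this
  omega

end Graded

/-! ### Extensions by two diagonal derivations. -/

section Extension

variable {G : Type*} [AddCommGroup G] [Module ℂ G]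

/-- The extension of an algebra by two commuting operators `P`, `Q`, with
`[u, x] = -[x, u] = P u` and `[u, y] = -[y, u] = Q u`. -/
def torusExt (brG : G →ₗ[ℂ] G →ₗ[ℂ] G) (P Q : G →ₗ[ℂ] G) :
    (G × ℂ × ℂ) →ₗ[ℂ] (G × ℂ × ℂ) →ₗ[ℂ] (G × ℂ × ℂ) :=
  LinearMap.mk₂ ℂ
    (fun u v => (brG u.1 v.1 + v.2.1 • P u.1 + v.2.2 • Q u.1 - u.2.1 • P v.1 - u.2.2 • Q v.1, 0))
    (by
      intro u u' v
      ext1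
      · simp only [Prod.fst_add, Prod.snd_add, map_add, LinearMap.add_apply]
        module
      · simp)
    (by
      intro a u v
      ext1
      · simp only [Prod.smul_fst, Prod.smul_snd, map_smul, LinearMap.smul_apply, smul_eq_mul]
        module
      · simp)
    (by
      intro u v v'
      ext1
      · simp only [Prod.fst_add, Prod.snd_add, map_add]
        module
      · simp)
    (by
      intro a u v
      ext1
      · simp only [Prod.smul_fst, Prod.smul_snd, map_smul, smul_eq_mul]
        module
      · simp)

variable {brG : G →ₗ[ℂ] G →ₗ[ℂ] G} {P Q : G →ₗ[ℂ] G}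

theorem torusExt_apply (u v : G × ℂ × ℂ) : torusExt brG P Q u v =
    (brG u.1 v.1 + v.2.1 • P u.1 + v.2.2 • Q u.1 - u.2.1 • P v.1 - u.2.2 • Q v.1, 0) := rfl

theorem torusExt_isLie (hG : IsLie brG)
    (hP : ∀ u v, P (brG u v) = brG (P u) v + brG u (P v))
    (hQ : ∀ u v, Q (brG u v) = brG (Q u) v + brG u (Q v))
    (hPQ : ∀ u, P (Q u) = Q (P u)) : IsLie (torusExt brG P Q) := by
  constructor
  · intro u
    rw [torusExt_apply, hG.1]
    ext1
    · simp only [Prod.fst_zero]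
      module
    · rfl
  · intro u v w
    simp only [torusExt_apply]
    ext1
    · simp only [Prod.fst_add, Prod.fst_zero, Prod.snd_zero, map_add, map_sub, map_smul, hP, hQ,
        hPQ, zero_smul, add_zero]
      have h1 := hG.2 u.1 v.1 w.1
      -- With the arguments in matching order the operator terms cancel in pairs, leaving the Jacobi
      -- sum of `brG`.
      rw [hG.skew (P v.1) w.1, hG.skew (P w.1) u.1, hG.skew (P u.1) v.1, hG.skew (Q v.1) w.1,
        hG.skew (Q w.1) u.1, hG.skew (Q u.1) v.1]
      refine Eq.trans ?_ h1
      module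
    · simp

/-- An extension of a graded algebra by two independent diagonal derivations belongs to the family
of that algebra. -/
theorem Graded.torusExt_inFamily {n : ℕ} {c : ℕ → ℕ → ℂ} (S : Graded n c brG) {g : ℕ}
    {p q : ℕ → ℂ} (hn : 1 ≤ n) (hg1 : 1 ≤ g) (hgn : g ≤ n) (hp1 : p 1 = 1) (hq1 : q 1 = 0)
    (hpg : p g = 0) (hqg : q g = 1) (hL : IsLie (torusExt brG (S.diag p) (S.diag q))) :
    InFamily brG 2 (torusExt brG (S.diag p) (S.diag q)) := by
  set br := torusExt brG (S.diag p) (S.diag q) with hbr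
  have hι : Function.Injective (LinearMap.inl ℂ G (ℂ × ℂ)) := LinearMap.inl_injective
  have hinl : ∀ u v : G, br (u, 0) (v, 0) = (brG u v, 0) := by
    intro u v
    simp [hbr, torusExt_apply]
  have hsnd : ∀ u v, br u v ∈ LinearMap.range (LinearMap.inl ℂ G (ℂ × ℂ)) :=
    fun u v => ⟨_, rfl⟩
  refine ⟨hL.isLeibniz, ⟨n + 1, ?_⟩, LinearMap.range (LinearMap.inl ℂ G (ℂ × ℂ)),
    LinearMap.range (LinearMap.inr ℂ G (ℂ × ℂ)), ⟨⟨?_, n, ?_⟩, ?_⟩,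
    LinearMap.isCompl_range_inl_inr, ?_, LinearEquiv.ofInjective _ hι, ?_⟩
  · have h : ∀ k, derivedSeries br (k + 1) ≤ (S.F (k + 1)).map (LinearMap.inl ℂ G (ℂ × ℂ)) := by
      intro k
      induction k with
      | zero =>
        rw [S.F_eq_top le_rfl, Submodule.map_top, derivedSeries, Submodule.map₂_le]
        exact fun u _ v _ => hsnd u v
      | succ k ih =>
        rw [derivedSeries, Submodule.map₂_le]
        intro u hu v hv
        obtain ⟨u, hu', rfl⟩ := ih hu
        obtain ⟨v, hv', rfl⟩ := ih hv
        exact ⟨_, S.F_anti (show k + 1 + 1 ≤ k + 1 + (k + 1) by omega) (S.br_mem hu' hv'),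
          (hinl u v).symm⟩
    have := h n
    rwa [S.F_eq_bot (Nat.lt_succ_self n), Submodule.map_bot, le_bot_iff] at this
  · exact fun x _ y => ⟨hsnd x y, hsnd y x⟩
  · have h : ∀ k, lowerCentralSeries br (LinearMap.range (LinearMap.inl ℂ G (ℂ × ℂ))) k ≤
        (S.F (k + 1)).map (LinearMap.inl ℂ G (ℂ × ℂ)) := by
      intro k
      induction k with
      | zero =>
        rw [S.F_eq_top le_rfl, Submodule.map_top]
        exact le_rfl
      | succ k ih =>
        rw [lowerCentralSeries, Submodule.map₂_le]
        rintro u hu _ ⟨v, rfl⟩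
        obtain ⟨u, hu', rfl⟩ := ih hu
        exact ⟨_, S.br_mem hu' (S.mem_F_one v), (hinl u v).symm⟩
    have := h n
    rwa [S.F_eq_bot (Nat.lt_succ_self n), Submodule.map_bot, le_bot_iff] at this
  · rintro I ⟨hI, k, hk⟩ ⟨u, a, b⟩ hu
    -- Right multiplication by `(u, a, b)` scales the coefficient in degree `i` of a vector of `F i`
    -- by `a p i + b q i`. Iterating from `f i` stays in the lower central series of `I`, so
    -- nilpotency makes this scalar zero; degrees `1` and `g` then give `a = b = 0`.
    have key : ∀ i, 1 ≤ i → i ≤ n → a * p i + b * q i = 0 := by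
      intro i hi hin
      have h : ∀ k, ∃ w, (w, (0 : ℂ × ℂ)) ∈ lowerCentralSeries br I k ∧ w ∈ S.F i ∧
          S.ξ i w = (a * p i + b * q i) ^ (k + 1) := by
        have step : ∀ w ∈ S.F i, br (w, 0) (u, a, b) =
            (brG w u + a • S.diag p w + b • S.diag q w, 0) ∧
            brG w u + a • S.diag p w + b • S.diag q w ∈ S.F i ∧
            S.ξ i (brG w u + a • S.diag p w + b • S.diag q w) =
              (a * p i + b * q i) * S.ξ i w := by
          intro w hw
          have h1 := S.br_mem hw (S.mem_F_one u)
          refine ⟨by simp [hbr, torusExt_apply], ?_, ?_⟩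
          · exact add_mem (add_mem (S.F_anti (Nat.le_succ i) h1)
              (Submodule.smul_mem _ _ ((S.tri_diag p).map_mem hw)))
              (Submodule.smul_mem _ _ ((S.tri_diag q).map_mem hw))
          · rw [map_add, map_add, map_smul, map_smul, (S.tri_diag p).ξ_map hi hin hw,
              (S.tri_diag q).ξ_map hi hin hw, S.ξ_of_mem h1 hi hin (Nat.lt_succ_self i)]
            simp only [smul_eq_mul]
            ring
        intro k
        induction k with
        | zero =>
          obtain ⟨h1, h2, h3⟩ := step _ (S.f_mem hi le_rfl)
          refine ⟨_, ?_, h2, by rw [h3, S.ξ_self hi hin, zero_add, pow_one, mul_one]⟩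
          rw [← h1]
          exact (hI _ hu _).2
        | succ k ih =>
          obtain ⟨w, hw, hwF, hwξ⟩ := ih
          obtain ⟨h1, h2, h3⟩ := step w hwF
          refine ⟨_, ?_, h2, by rw [h3, hwξ, pow_succ' _ (k + 1)]⟩
          rw [← h1]
          exact Submodule.apply_mem_map₂ _ hw hu
      obtain ⟨w, hw, -, hwξ⟩ := h k
      rw [hk, Submodule.mem_bot] at hw
      have hw0 : w = 0 := congrArg Prod.fst hw
      rw [hw0, map_zero, eq_comm] at hwξ
      exact eq_zero_of_pow_eq_zero hwξ
    have h1 := key 1 le_rfl hn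
    have h2 := key g hg1 hgn
    rw [hp1, hq1] at h1
    rw [hpg, hqg] at h2
    simp only [mul_one, mul_zero, add_zero, zero_add] at h1 h2
    exact ⟨u, by rw [h1, h2]; rfl⟩
  · rw [LinearMap.finrank_range_of_inj LinearMap.inr_injective]
    simp
  · exact fun u v => (hinl u v).symm

end Extension

/-! ### Uniqueness of the extension of rank two. -/

section Uniqueness

variable {R G : Type*} [AddCommGroup R] [Module ℂ R] [AddCommGroup G] [Module ℂ G]
  {br : R →ₗ[ℂ] R →ₗ[ℂ] R} {brG : G →ₗ[ℂ] G →ₗ[ℂ] G}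
  {ι : G →ₗ[ℂ] R} {D : R →ₗ[ℂ] G →ₗ[ℂ] G}

/-- A Leibniz algebra containing all brackets in a Lie ideal whose center lies in its derived
algebra is Lie if some element acts injectively on that ideal. -/
theorem bracket_self_eq_zero (hL : IsLeibniz br) (hι : Function.Injective ι)
    (hom : ∀ u v, ι (brG u v) = br (ι u) (ι v)) (hD : ∀ r u, ι (D r u) = br (ι u) r)
    (hbr : ∀ r s, br r s ∈ LinearMap.range ι) (hskew : ∀ u v, brG u v = -brG v u)
    (hZ : ∀ z, (∀ u, brG u z = 0) → z ∈ Submodule.map₂ brG ⊤ ⊤)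
    (h : R) (hinj : Function.Injective (D h)) (r : R) : br r r = 0 := by
  have hpol : ∀ s a b, br s (br a b + br b a) = 0 := by
    intro s a b
    rw [map_add, hL, hL]
    abel
  -- The defect `[h, ι u] + [ι u, h]` is a symmetrized bracket, so by `hpol` it is annihilated from
  -- the left. Skew-symmetry of `brG` then makes it central in the ideal.
  have hA : ∀ u t, br (br h (ι u)) (ι t) = -ι (brG (D h u) t) := by
    intro u t
    obtain ⟨z, hz⟩ := add_mem (hbr h (ι u)) (hbr (ι u) h)
    have hzt : brG z t = 0 := by
      rw [hskew, neg_eq_zero]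
      apply hι
      rw [hom, hz, hpol, map_zero]
    have h1 : br (ι z) (ι t) = 0 := by rw [← hom, hzt, map_zero]
    rw [hz, map_add, LinearMap.add_apply, ← hD, ← hom] at h1
    exact eq_neg_of_add_eq_zero_left h1
  -- On brackets of the ideal, left multiplication by `h` is minus the right one: expand `[h, [u,
  -- v]]` and use `hA`.
  have hB : Submodule.map₂ brG ⊤ ⊤ ≤ LinearMap.ker ((br h).comp ι + ι.comp (D h)) := by
    refine Submodule.map₂_le.2 fun u _ v _ => ?_
    rw [LinearMap.mem_ker, LinearMap.add_apply, LinearMap.comp_apply, LinearMap.comp_apply,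
      action_derivation hL hι hom hD, hom, hL, hA, hA, hskew (D h v) u, map_neg, map_add]
    abel
  obtain ⟨z, hz⟩ := hbr r r
  have hzc : ∀ u, brG u z = 0 := by
    intro u
    apply hι
    rw [hom, hz, hL, sub_self, map_zero]
  -- The square `[r, r]` is central and annihilated by left multiplication by `h`. By `hB` right
  -- multiplication by `h` kills it as well, and that is injective.
  have h1 := hB (hZ z hzc)
  rw [LinearMap.mem_ker, LinearMap.add_apply, LinearMap.comp_apply, LinearMap.comp_apply, hz,
    hL, sub_self, zero_add, ← map_zero ι] at h1
  have h2 : z = 0 := hinj (by rw [hι h1, map_zero])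
  rw [← hz, h2, map_zero]

/-- If all derivations of a graded algebra are triangular with diagonals spanned by `p` and `q`,
then its only extension in the family of rank two is the diagonal one. -/
theorem Graded.RankTwo.isomorphic_torusExt {n : ℕ} {c : ℕ → ℕ → ℂ} {S : Graded n c brG} {g : ℕ}
    {p q : ℕ → ℂ} (h : S.RankTwo g p q) (hn : 1 ≤ n) (hg1 : 1 ≤ g) (hgn : g ≤ n)
    (hskew : ∀ u v, brG u v = -brG v u)
    (hZ : ∀ z, (∀ u, brG u z = 0) → z ∈ Submodule.map₂ brG ⊤ ⊤)
    (hp : WeightAdditive n c p) (hq : WeightAdditive n c q) (B : ℂ)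
    (hne : ∀ i, 1 ≤ i → i ≤ n → p i + B * q i ≠ 0)
    (hinj : ∀ i k, 1 ≤ i → i < k → k ≤ n → p k + B * q k ≠ p i + B * q i)
    (hgen : WeightGeneric n c (fun i => p i + B * q i)) (hF : InFamily brG 2 br) :
    Isomorphic br (torusExt brG (S.diag p) (S.diag q)) := by
  obtain ⟨hL, hs, ι, D, Q, hι, hom, hD, hN, hNQ, hQ⟩ := hF.exists_action
  obtain ⟨hχ, hker⟩ := h.ker_weight hn hg1 hgn hL hs hN hι hom hD
  have htri := h.tri hL hι hom hD
  set χ := S.weight g D with hχdef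
  have hmem : ∀ r, χ r = 0 → ∃ u, ι u = r := by
    intro r hr
    have : r ∈ LinearMap.ker χ := hr
    rwa [hker] at this
  have hχι : ∀ u, χ (ι u) = 0 := by
    intro u
    have : ι u ∈ LinearMap.range ι := ⟨u, rfl⟩
    rwa [← hker] at this
  have hsurj : Function.Surjective χ := by
    have hi : Function.Injective (χ ∘ₗ Q.subtype) := by
      rw [injective_iff_map_eq_zero]
      rintro ⟨r, hr⟩ h0
      obtain ⟨u, hu⟩ := hmem r h0
      exact Subtype.ext ((Submodule.disjoint_def.1 hNQ.disjoint) r ⟨u, hu⟩ hr)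
    have : FiniteDimensional ℂ Q := Module.finite_of_finrank_pos (by omega)
    have h2 := (LinearMap.injective_iff_surjective_of_finrank_eq_finrank
      (by rw [hQ]; simp)).1 hi
    exact fun w => (h2 w).elim fun r hr => ⟨r, hr⟩
  obtain ⟨t, ht⟩ := hsurj (1, B)
  have httri : S.Tri (D t) (fun i => p i + B * q i) := by
    have := htri t
    rw [ht] at this
    simpa only [one_mul] using this
  have htinj := httri.injective hne
  have := S.finiteDimensional
  have htsurj := LinearMap.surjective_of_injective htinj
  -- The error `[r, t]` lies in the ideal, on which `t` acts surjectively, so subtracting an element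
  -- of the ideal removes it without changing the weight.
  have hcent : ∀ w, ∃ r, χ r = w ∧ br r t = 0 := by
    intro w
    obtain ⟨r, hr⟩ := hsurj w
    obtain ⟨u, hu⟩ := hmem _ (hχ r t)
    obtain ⟨v, hv⟩ := htsurj u
    refine ⟨r - ι v, by rw [map_sub, hr, hχι, sub_zero], ?_⟩
    rw [map_sub, LinearMap.sub_apply, ← hD, hv, hu, sub_self]
  obtain ⟨x, hx, hxt⟩ := hcent (1, 0)
  obtain ⟨y, hy, hyt⟩ := hcent (0, 1)
  -- Applying `t` to `[a, b]` gives zero by the Leibniz identity, while `[a, b]` lies in the ideal,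
  -- where `t` acts injectively.
  have habel : ∀ a b, br a t = 0 → br b t = 0 → br a b = 0 := by
    intro a b ha hb
    obtain ⟨w, hw⟩ := hmem _ (hχ a b)
    have h1 := hL a b t
    rw [hb, ha, map_zero, map_zero, LinearMap.zero_apply, sub_zero, ← hw, ← hD, ← map_zero ι] at h1
    have h2 : w = 0 := htinj (by rw [map_zero, ← hι h1])
    rw [← hw, h2, map_zero]
  have hcomm : ∀ a, br a t = 0 → ∀ u, D t (D a u) = D a (D t u) := by
    intro a ha u
    have h1 := action_br hL hι hD a t u
    rw [ha, map_zero, LinearMap.zero_apply] at h1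
    exact (sub_eq_zero.1 h1.symm)
  have hself := bracket_self_eq_zero hL hι hom hD (fun r s => hmem _ (hχ r s)) hskew hZ t htinj
  have hRskew : ∀ a b, br a b = -br b a := by
    intro a b
    have h1 := hself (a + b)
    simp only [map_add, LinearMap.add_apply, hself a, hself b, zero_add, add_zero] at h1
    exact eq_neg_of_add_eq_zero_right h1
  obtain ⟨θ, hθ, hθD⟩ := S.exists_diagonalizing_automorphism
    (action_derivation hL hι hom hD t) httri hinj
    (fun i j hi hj hij hc => by rw [hp i j hi hj hij hc, hq i j hi hj hij hc]; ring) hgen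
  have hxD : ∀ u, br (ι (θ u)) x = ι (θ (S.diag p u)) := by
    intro u
    rw [← hD]
    refine congrArg ι (hθD (D x) p ?_ (hcomm x hxt) u)
    have := htri x
    rw [hx] at this
    simpa only [one_mul, zero_mul, add_zero] using this
  have hyD : ∀ u, br (ι (θ u)) y = ι (θ (S.diag q u)) := by
    intro u
    rw [← hD]
    refine congrArg ι (hθD (D y) q ?_ (hcomm y hyt) u)
    have := htri y
    rw [hy] at this
    simpa only [one_mul, zero_mul, zero_add] using this
  let Ψ : (G × ℂ × ℂ) →ₗ[ℂ] R := (ι ∘ₗ (θ : G →ₗ[ℂ] G)).coprod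
    ((LinearMap.toSpanSingleton ℂ R x).coprod (LinearMap.toSpanSingleton ℂ R y))
  have hΨ : ∀ u, Ψ u = ι (θ u.1) + (u.2.1 • x + u.2.2 • y) := fun u => rfl
  have hΨχ : ∀ u, χ (Ψ u) = u.2 := by
    intro u
    rw [hΨ, map_add, hχι, map_add, map_smul, map_smul, hx, hy]
    simp
  have hΨinj : Function.Injective Ψ := by
    rw [injective_iff_map_eq_zero]
    intro u hu
    have h1 := hΨχ u
    rw [hu, map_zero] at h1
    have h2 := hΨ u
    rw [hu, ← h1] at h2
    simp only [Prod.fst_zero, Prod.snd_zero, zero_smul, add_zero] at h2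
    have h3 : u.1 = 0 := by
      apply θ.injective
      apply hι
      rw [← h2, map_zero, map_zero]
    exact Prod.ext h3 h1.symm
  have hΨsurj : Function.Surjective Ψ := by
    intro r
    obtain ⟨u, hu⟩ := hmem (r - Ψ (0, χ r)) (by rw [map_sub, hΨχ, sub_self])
    refine ⟨(θ.symm u, 0) + (0, χ r), ?_⟩
    rw [map_add]
    have : Ψ (θ.symm u, 0) = ι u := by rw [hΨ]; simp
    rw [this, hu, sub_add_cancel]
  refine Isomorphic.symm ⟨LinearEquiv.ofBijective Ψ ⟨hΨinj, hΨsurj⟩, ?_⟩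
  intro u v
  change Ψ _ = br (Ψ u) (Ψ v)
  rw [hΨ, hΨ, hΨ, torusExt_apply]
  simp only [map_add, map_sub, map_smul, LinearMap.add_apply, LinearMap.smul_apply, hθ, hom,
    hxD, hyD, hRskew x (ι (θ v.1)), hRskew y (ι (θ v.1)), habel x x hxt hxt, habel x y hxt hyt,
    habel y x hyt hxt, habel y y hyt hyt, Prod.fst_zero, Prod.snd_zero, zero_smul, smul_zero]
  module

end Uniqueness

/-! ### Leading terms of derivations and of central elements. -/

namespace Graded

section Derivations

variable {G : Type*} [AddCommGroup G] [Module ℂ G] {br : G →ₗ[ℂ] G →ₗ[ℂ] G}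
  {n : ℕ} {c : ℕ → ℕ → ℂ} {S : Graded n c br} {D : G →ₗ[ℂ] G}

theorem br_mem_of_le (S : Graded n c br) {i j k : ℕ} {u v : G} (hu : u ∈ S.F i) (hv : v ∈ S.F j)
    (hk : k ≤ i + j) : br u v ∈ S.F k := S.F_anti hk (S.br_mem hu hv)

theorem derivation_smul_f (S : Graded n c br)
    (hD : ∀ u v, D (br u v) = br (D u) v + br u (D v)) {i j : ℕ} (hi : 1 ≤ i) (hj : 1 ≤ j) :
    c i j • D (S.f (i + j)) = br (D (S.f i)) (S.f j) + br (S.f i) (D (S.f j)) := by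
  rw [← hD, S.br_f i j hi hj, map_smul]

/-- Since `c i j` is invertible, `f (i + j)` is a multiple of a bracket, and the derivation rule
adds the leading coefficients. -/
theorem derivation_lead (hD : ∀ u v, D (br u v) = br (D u) v + br u (D v)) {i j : ℕ} {s t : ℂ}
    (hi : 1 ≤ i) (hj : 1 ≤ j) (hc : c i j ≠ 0) (hs : D (S.f i) - s • S.f i ∈ S.F (i + 1))
    (ht : D (S.f j) - t • S.f j ∈ S.F (j + 1)) :
    D (S.f (i + j)) - (s + t) • S.f (i + j) ∈ S.F (i + j + 1) := by
  have h1 := S.br_lead (v := S.f j) (t := 1) hi hj hs (by simp)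
  have h2 := S.br_lead (u := S.f i) (s := 1) hi hj (by simp) ht
  have h3 := Submodule.smul_mem _ (c i j)⁻¹ (add_mem h1 h2)
  convert h3 using 1
  have h4 := S.derivation_smul_f hD hi hj
  have h5 : D (S.f (i + j)) = (c i j)⁻¹ • (c i j • D (S.f (i + j))) := by
    rw [smul_smul, inv_mul_cancel₀ hc, one_smul]
  rw [h5, h4]
  match_scalars
  · field_simp
  · field_simp
  · field_simp
    ring

theorem Tri.weight_add (hD : ∀ u v, D (br u v) = br (D u) v + br u (D v)) {d : ℕ → ℂ}
    (h : S.Tri D d) {i j : ℕ} (hi : 1 ≤ i) (hj : 1 ≤ j) (hn : i + j ≤ n) (hc : c i j ≠ 0) :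
    d (i + j) = d i + d j := by
  have h1 := derivation_lead hD hi hj hc (h i hi (by omega)) (h j hj (by omega))
  have h2 := Submodule.sub_mem _ h1 (h (i + j) (by omega) hn)
  rw [sub_sub_sub_cancel_left, ← sub_smul] at h2
  have h3 := S.eq_zero_of_smul_f_mem (by omega) hn (Nat.lt_succ_self _) h2
  linear_combination h3

/-- The bracket with `f i` has leading coefficient `c i j` times that of `z`, so the latter must
vanish. -/
theorem mem_succ_of_central {i j : ℕ} {z : G} (hi : 1 ≤ i) (hj : 1 ≤ j) (hn : i + j ≤ n)
    (hc : c i j ≠ 0) (hz : br (S.f i) z = 0) (h : z ∈ S.F j) : z ∈ S.F (j + 1) := by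
  have h1 := S.br_lead (u := S.f i) (s := 1) hi hj (by simp) (S.sub_mem hj h)
  rw [hz, zero_sub, neg_mem_iff] at h1
  have h2 := S.eq_zero_of_smul_f_mem (by omega) hn (Nat.lt_succ_self _) h1
  rw [one_mul] at h2
  exact S.mem_succ hj h ((mul_eq_zero.1 h2).resolve_right hc)

theorem f_mem_map₂ {i j : ℕ} (hi : 1 ≤ i) (hj : 1 ≤ j) (hc : c i j ≠ 0) :
    S.f (i + j) ∈ Submodule.map₂ br ⊤ ⊤ := by
  have h := Submodule.smul_mem _ (c i j)⁻¹
    (Submodule.apply_mem_map₂ br (Submodule.mem_top (x := S.f i)) (Submodule.mem_top (x := S.f j)))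
  rwa [S.br_f i j hi hj, smul_smul, inv_mul_cancel₀ hc, one_smul] at h

theorem F_le_map₂ {k : ℕ} (h : ∀ i, k ≤ i → 1 ≤ i → i ≤ n → S.f i ∈ Submodule.map₂ br ⊤ ⊤) :
    S.F k ≤ Submodule.map₂ br ⊤ ⊤ := by
  rw [F, Submodule.span_le]
  rintro _ ⟨i, hi, rfl⟩
  rcases lt_or_ge n i with hn | hn
  · simp [S.f_eq_zero i hn]
  · exact h i hi.2 hi.1 hn

/-- The leading term of `w` is parallel to `f i` and drops out by skew-symmetry, which gains one
degree. -/
theorem br_f_mem_of_lead (S : Graded n c br) (hc : ∀ i j, c j i = -c i j) {i : ℕ} {w : G}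
    {t : ℂ} (hi : 1 ≤ i) (h : w - t • S.f i ∈ S.F (i + 1)) :
    br (S.f i) w ∈ S.F (i + i + 1) := by
  have hcc : c i i = 0 := self_eq_neg.1 (hc i i)
  have := S.br_lead (u := S.f i) (s := 1) hi hi (by simp) h
  simpa [hcc] using this

end Derivations

/-! ### Derivations when `f 1` and `f 2` generate. -/

section Filiform

variable {G : Type*} [AddCommGroup G] [Module ℂ G] {br : G →ₗ[ℂ] G →ₗ[ℂ] G}
  {n : ℕ} {c : ℕ → ℕ → ℂ} {S : Graded n c br} {D : G →ₗ[ℂ] G}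

/-- The diagonals of the derivations of a filiform-type algebra are spanned by `filiformP` and
`filiformQ`. -/
def filiformP (n i : ℕ) : ℂ := if i = n then (n : ℂ) - 4 else if i = 1 then 1 else (i : ℂ) - 2

def filiformQ (n i : ℕ) : ℂ := if i = n then 2 else if i = 1 then 0 else 1

/-- `f 1` and `f 2` generate the algebra, so the diagonal follows from their leading coefficients.
The one obstacle to triangularity is an `f 1`-component `t` of `D (f 2)`. -/
theorem filiform_rankTwo (hn : 6 ≤ n) (hc : ∀ i j, c j i = -c i j)
    (hc1 : ∀ i, 2 ≤ i → i + 2 ≤ n → c 1 i = 1) (hc2 : c 2 (n - 2) ≠ 0) :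
    S.RankTwo 2 (filiformP n) (filiformQ n) := by
  intro D hD
  set a := S.ξ 1 (D (S.f 1)) with ha
  set b := S.ξ 2 (D (S.f 2)) with hb
  set t := S.ξ 1 (D (S.f 2)) with ht
  have h1 : D (S.f 1) - a • S.f 1 ∈ S.F 2 := S.sub_mem le_rfl (S.mem_F_one _)
  have h2 : D (S.f 2) - t • S.f 1 ∈ S.F 2 := S.sub_mem le_rfl (S.mem_F_one _)
  have hE : ∀ i, 3 ≤ i → i + 1 ≤ n → D (S.f i) ∈ S.F i := by
    intro i hi
    induction i, hi using Nat.le_induction with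
    | base =>
      intro _
      have h3 := S.derivation_smul_f hD (i := 1) (j := 2) le_rfl (by omega)
      rw [hc1 2 le_rfl (by omega), one_smul] at h3
      rw [h3]
      exact add_mem (S.br_mem_of_le (S.mem_F_one _) (S.f_mem (i := 2) (by omega) le_rfl) (by omega))
        (S.br_f_mem_of_lead (i := 1) hc le_rfl h2)
    | succ i hi ih =>
      intro hin
      have h3 := S.derivation_smul_f hD (i := 1) (j := i) le_rfl (by omega)
      rw [hc1 i (by omega) (by omega), one_smul, add_comm 1 i] at h3
      rw [h3, add_comm i 1]
      exact add_mem (S.br_mem_of_le (S.mem_F_one _) (S.f_mem (by omega) le_rfl) le_rfl)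
        (S.br_mem_of_le (S.f_mem le_rfl le_rfl) (ih (by omega)) le_rfl)
  -- Applying `D` to `[f 2, f 3]` gives an element of `F 5`, while the only contribution of degree
  -- `4` is `t • f 4`. The value of `c 2 3` is irrelevant, and `6 ≤ n` keeps degree `5` below the
  -- last one.
  have ht0 : t = 0 := by
    have h3 : c 2 3 • D (S.f 5) = br (D (S.f 2)) (S.f 3) + br (S.f 2) (D (S.f 3)) :=
      S.derivation_smul_f hD (by omega) (by omega)
    have f13 : br (S.f 1) (S.f 3) = S.f 4 := by
      rw [S.br_f 1 3 le_rfl (by omega), hc1 3 (by omega) (by omega), one_smul]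
    have h4 : br (D (S.f 2) - t • S.f 1) (S.f 3) ∈ S.F 5 :=
      S.br_mem_of_le h2 (S.f_mem (i := 3) (by omega) le_rfl) (by omega)
    have h5 : br (S.f 2) (D (S.f 3)) ∈ S.F 5 :=
      S.br_mem_of_le (S.f_mem (i := 2) (by omega) le_rfl) (hE 3 le_rfl (by omega)) (by omega)
    have h6 := Submodule.smul_mem _ (c 2 3) (hE 5 (by omega) (by omega))
    have h7 : t • S.f 4 ∈ S.F 5 := by
      rw [h3, ← sub_add_cancel (D (S.f 2)) (t • S.f 1), map_add, LinearMap.add_apply,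
        map_smul, LinearMap.smul_apply, f13, add_assoc, add_mem_cancel_left h4,
        add_mem_cancel_right h5] at h6
      exact h6
    exact S.eq_zero_of_smul_f_mem (by omega) (by omega) (by omega) h7
  have h2' : D (S.f 2) - b • S.f 2 ∈ S.F 3 :=
    S.sub_mem (by omega) (by simpa [ht0] using h2)
  have hmid : ∀ i, 2 ≤ i → i + 1 ≤ n →
      D (S.f i) - (a * ((i : ℂ) - 2) + b) • S.f i ∈ S.F (i + 1) := by
    intro i hi
    induction i, hi using Nat.le_induction with
    | base => intro _; simpa using h2'
    | succ i hi ih =>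
      intro hin
      have h3 := derivation_lead hD (i := 1) (j := i) le_rfl (by omega)
        (by rw [hc1 i hi (by omega)]; exact one_ne_zero) h1 (ih (by omega))
      rw [add_comm 1 i] at h3
      convert h3 using 3
      push_cast
      ring
  intro i hi hin
  -- The last degree is not reached by `f 1`; its weight comes from `[f 2, f (n - 2)]`.
  rcases eq_or_ne i n with rfl | hne
  · have h3 := derivation_lead hD (i := 2) (j := i - 2) (by omega) (by omega) hc2 h2'
      (hmid (i - 2) (by omega) (by omega))
    rw [show 2 + (i - 2) = i by omega] at h3
    convert h3 using 3
    simp only [filiformP, filiformQ, if_true]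
    rw [Nat.cast_sub (by omega)]
    push_cast
    ring
  · rcases eq_or_ne i 1 with rfl | hne1
    · simpa [filiformP, filiformQ, hne] using h1
    · simpa [filiformP, filiformQ, hne, hne1] using hmid i (by omega) (by omega)

/-- Brackets with `f 2` and `f (n - 2)` remove the components of a central element in degrees `1`
and `2`; all higher basis vectors are brackets. -/
theorem filiform_center_le (S : Graded n c br) (hn : 6 ≤ n) (hc : ∀ i j, c j i = -c i j)
    (hc1 : ∀ i, 2 ≤ i → i + 2 ≤ n → c 1 i = 1) (hc2 : c 2 (n - 2) ≠ 0) (z : G)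
    (hz : ∀ u, br u z = 0) : z ∈ Submodule.map₂ br ⊤ ⊤ := by
  have h2 : z ∈ S.F 2 := mem_succ_of_central (i := 2) (by omega) le_rfl (by omega)
    (by rw [hc, hc1 2 le_rfl (by omega)]; simp) (hz _) (S.mem_F_one z)
  have h3 : z ∈ S.F 3 := mem_succ_of_central (i := n - 2) (by omega) (by omega) (by omega)
    (by rw [hc]; simpa using hc2) (hz _) h2
  refine S.F_le_map₂ ?_ h3
  intro i hi _ hin
  rcases eq_or_ne i n with rfl | hne
  · have := S.f_mem_map₂ (i := 2) (j := i - 2) (by omega) (by omega) hc2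
    rwa [show 2 + (i - 2) = i by omega] at this
  · have := S.f_mem_map₂ (i := 1) (j := i - 1) (by omega) (by omega)
      (by rw [hc1 (i - 1) (by omega) (by omega)]; exact one_ne_zero)
    rwa [show 1 + (i - 1) = i by omega] at this

/-- Weights add along `[f 2, f 3]`: with `a`, `b` the entries in degrees `1` and `2`, `3a + b = b +
(a + b)`. -/
theorem filiform_proportional (S : Graded n c br) (hn : 6 ≤ n) (hc : ∀ i j, c j i = -c i j)
    (hc1 : ∀ i, 2 ≤ i → i + 2 ≤ n → c 1 i = 1) (hc2 : c 2 (n - 2) ≠ 0) (hc3 : c 2 3 ≠ 0)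
    (hD : ∀ u v, D (br u v) = br (D u) v + br u (D v)) :
    S.ξ 2 (D (S.f 2)) = 2 * S.ξ 1 (D (S.f 1)) := by
  have h := (filiform_rankTwo (S := S) hn hc hc1 hc2 D hD).weight_add hD (i := 2) (j := 3) (by omega)
    (by omega) (by omega) hc3
  have h2 : 2 ≠ n := by omega
  have h3 : 3 ≠ n := by omega
  have h5 : 5 ≠ n := by omega
  norm_num [filiformP, filiformQ, h2, h3, h5] at h
  linear_combination -h

end Filiform

/-! ### Derivations when `f 1`, `f 2` and `f 3` generate. -/

section QuasiFiliform

variable {G : Type*} [AddCommGroup G] [Module ℂ G] {br : G →ₗ[ℂ] G →ₗ[ℂ] G}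
  {n : ℕ} {c : ℕ → ℕ → ℂ} {S : Graded n c br} {D : G →ₗ[ℂ] G}

/-- The diagonals of the derivations of an algebra in which `f 1` acts as a shift and `f 2` as minus
its square are spanned by `shiftP` and `shiftQ`. -/
def shiftP (i : ℕ) : ℂ := if i = 1 then 1 else if i = 2 then 2 else (i : ℂ) - 3

def shiftQ (i : ℕ) : ℂ := if i = 1 then 0 else if i = 2 then 0 else 1

/-- Three components below the diagonal degree must be excluded: `t` in `D (f 2)` and `r`, `s` in `D
(f 3)`. The weight of `f 2` is forced to be `2a`, because `[f 2, f 3]` reaches the same `f 5` as two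
applications of `f 1` to `f 3`. -/
theorem shift_rankTwo (hn : 6 ≤ n) (hc : ∀ i j, c j i = -c i j) (hc12 : c 1 2 = 0)
    (hc1 : ∀ i, 3 ≤ i → i + 1 ≤ n → c 1 i = 1) (hc2 : ∀ i, 3 ≤ i → i + 2 ≤ n → c 2 i = -1) :
    S.RankTwo 3 shiftP shiftQ := by
  intro D hD
  set a := S.ξ 1 (D (S.f 1)) with ha
  set b := S.ξ 3 (D (S.f 3)) with hb
  set t := S.ξ 1 (D (S.f 2)) with ht
  set r := S.ξ 1 (D (S.f 3)) with hr
  set s := S.ξ 2 (D (S.f 3)) with hs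
  have h1 : D (S.f 1) - a • S.f 1 ∈ S.F 2 := S.sub_mem le_rfl (S.mem_F_one _)
  have h2 : D (S.f 2) - t • S.f 1 ∈ S.F 2 := S.sub_mem le_rfl (S.mem_F_one _)
  have h3 : D (S.f 3) - r • S.f 1 - s • S.f 2 ∈ S.F 3 := by
    have h := S.sub_mem (k := 1) le_rfl (S.mem_F_one (D (S.f 3)))
    have h' := S.sub_mem (by omega) h
    rwa [map_sub, map_smul, S.ξ_of_ne (i := 2) (j := 1) (by omega) (by omega) (by omega),
      smul_zero, sub_zero] at h'
  have f11 : br (S.f 1) (S.f 1) = 0 := by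
    rw [S.br_f 1 1 le_rfl le_rfl, self_eq_neg.1 (hc 1 1), zero_smul]
  have f22 : br (S.f 2) (S.f 2) = 0 := by
    rw [S.br_f 2 2 (by omega) (by omega), self_eq_neg.1 (hc 2 2), zero_smul]
  have f12 : br (S.f 1) (S.f 2) = 0 := by
    rw [S.br_f 1 2 le_rfl (by omega), hc12, zero_smul]
  have f21 : br (S.f 2) (S.f 1) = 0 := by
    rw [S.br_f 2 1 (by omega) le_rfl, hc 1 2, hc12, neg_zero, zero_smul]
  have f1 : ∀ i, 3 ≤ i → i + 1 ≤ n → br (S.f 1) (S.f i) = S.f (i + 1) := by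
    intro i hi hin
    rw [S.br_f 1 i le_rfl (by omega), hc1 i hi hin, one_smul, add_comm]
  have f2 : ∀ i, 3 ≤ i → i + 2 ≤ n → br (S.f 2) (S.f i) = -S.f (i + 2) := by
    intro i hi hin
    rw [S.br_f 2 i (by omega) (by omega), hc2 i hi hin, neg_smul, one_smul, add_comm]
  have hE : ∀ i, 4 ≤ i → D (S.f i) ∈ S.F i := by
    intro i hi
    induction i, hi using Nat.le_induction with
    | base =>
      rw [← f1 3 le_rfl (by omega), hD]
      have h4 := S.br_mem_of_le (k := 4) (S.f_mem (i := 1) le_rfl le_rfl) h3 (by omega)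
      simp only [map_sub, map_smul, f11, f12, smul_zero, sub_zero] at h4
      exact add_mem
        (S.br_mem_of_le (S.mem_F_one _) (S.f_mem (i := 3) (by omega) le_rfl) (by omega)) h4
    | succ i hi ih =>
      rcases lt_or_ge n (i + 1) with hin | hin
      · simp [S.f_eq_zero _ hin]
      rw [← f1 i (by omega) hin, hD, add_comm i 1]
      exact add_mem (S.br_mem_of_le (S.mem_F_one _) (S.f_mem (by omega) le_rfl) le_rfl)
        (S.br_mem_of_le (S.f_mem le_rfl le_rfl) ih le_rfl)
  have ht0 : t = 0 := by
    have h4 : D (-S.f 5) = br (D (S.f 2)) (S.f 3) + br (S.f 2) (D (S.f 3)) := by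
      rw [← f2 3 le_rfl (by omega), hD]
    have h5 : br (D (S.f 2) - t • S.f 1) (S.f 3) ∈ S.F 5 :=
      S.br_mem_of_le h2 (S.f_mem (i := 3) (by omega) le_rfl) (by omega)
    have h6 : br (S.f 2) (D (S.f 3) - r • S.f 1 - s • S.f 2) ∈ S.F 5 :=
      S.br_mem_of_le (S.f_mem (i := 2) (by omega) le_rfl) h3 (by omega)
    simp only [map_sub, map_smul, f21, f22, smul_zero, sub_zero] at h6
    have h8 : D (-S.f 5) ∈ S.F 5 := by
      rw [map_neg]
      exact neg_mem (hE 5 (by omega))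
    have h7 : t • S.f 4 ∈ S.F 5 := by
      rw [h4, ← sub_add_cancel (D (S.f 2)) (t • S.f 1), map_add, LinearMap.add_apply,
        map_smul, LinearMap.smul_apply, f1 3 le_rfl (by omega), add_assoc,
        add_mem_cancel_left h5, add_mem_cancel_right h6] at h8
      exact h8
    exact S.eq_zero_of_smul_f_mem (by omega) (by omega) (by omega) h7
  -- Apply `D` to `[f 3, f 4]`: below degree `7` only the products of `r • f 1 + s • f 2` with `f 4`
  -- remain. This holds for any `c 3 4`, even zero, and also for `n = 6`, where `f 7 = 0`.
  have hrs : r • S.f 5 - s • S.f 6 ∈ S.F 7 := by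
    have h4 : c 3 4 • D (S.f 7) = br (D (S.f 3)) (S.f 4) + br (S.f 3) (D (S.f 4)) :=
      S.derivation_smul_f hD (by omega) (by omega)
    have h5 : br (D (S.f 3) - r • S.f 1 - s • S.f 2) (S.f 4) ∈ S.F 7 :=
      S.br_mem_of_le h3 (S.f_mem (i := 4) (by omega) le_rfl) (by omega)
    have h6 : br (S.f 3) (D (S.f 4)) ∈ S.F 7 :=
      S.br_mem_of_le (S.f_mem (i := 3) (by omega) le_rfl) (hE 4 le_rfl) (by omega)
    have h8 := Submodule.smul_mem _ (c 3 4) (hE 7 (by omega))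
    have e : D (S.f 3) = (D (S.f 3) - r • S.f 1 - s • S.f 2) + (r • S.f 1 + s • S.f 2) := by
      abel
    rw [h4, e, map_add, LinearMap.add_apply, add_mem_cancel_right h6, add_mem_cancel_left h5,
      map_add, map_smul, map_smul, LinearMap.add_apply, LinearMap.smul_apply,
      LinearMap.smul_apply, f1 4 (by omega) (by omega), f2 4 (by omega) (by omega), smul_neg,
      ← sub_eq_add_neg] at h8
    exact h8
  have hr0 : r = 0 := by
    have h6 : s • S.f 6 ∈ S.F 6 := Submodule.smul_mem _ _ (S.f_mem (by omega) le_rfl)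
    have h7 := add_mem (S.F_anti (show 6 ≤ 7 by omega) hrs) h6
    rw [sub_add_cancel] at h7
    exact S.eq_zero_of_smul_f_mem (by omega) (by omega) (by omega) h7
  have hs0 : s = 0 := by
    rw [hr0, zero_smul, zero_sub, neg_mem_iff] at hrs
    exact S.eq_zero_of_smul_f_mem (by omega) (by omega) (by omega) hrs
  have h3' : D (S.f 3) - b • S.f 3 ∈ S.F 4 :=
    S.sub_mem (by omega) (by simpa [hr0, hs0] using h3)
  have hmid : ∀ i, 3 ≤ i → i ≤ n →
      D (S.f i) - (a * ((i : ℂ) - 3) + b) • S.f i ∈ S.F (i + 1) := by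
    intro i hi
    induction i, hi using Nat.le_induction with
    | base => intro _; simpa using h3'
    | succ i hi ih =>
      intro hin
      have h3 := derivation_lead hD (i := 1) (j := i) le_rfl (by omega)
        (by rw [hc1 i hi (by omega)]; exact one_ne_zero) h1 (ih (by omega))
      rw [add_comm 1 i] at h3
      convert h3 using 3
      push_cast
      ring
  have h22 : D (S.f 2) - S.ξ 2 (D (S.f 2)) • S.f 2 ∈ S.F 3 :=
    S.sub_mem (by omega) (by simpa [ht0] using h2)
  have hd2 : S.ξ 2 (D (S.f 2)) = a * 2 := by
    have h4 := derivation_lead hD (i := 2) (j := 3) (by omega) (by omega)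
      (by rw [hc2 3 le_rfl (by omega)]; simp) h22 h3'
    have h5 := Submodule.sub_mem _ h4 (hmid 5 (by omega) (by omega))
    rw [sub_sub_sub_cancel_left, ← sub_smul] at h5
    have h6 := S.eq_zero_of_smul_f_mem (by omega) (by omega) (by omega) h5
    push_cast at h6
    linear_combination -h6
  rw [hd2] at h22
  intro i hi hin
  rcases eq_or_ne i 1 with rfl | hne1
  · simpa [shiftP, shiftQ] using h1
  rcases eq_or_ne i 2 with rfl | hne2
  · simpa [shiftP, shiftQ] using h22
  · simpa [shiftP, shiftQ, hne1, hne2] using hmid i (by omega) (by omega)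

/-- Brackets with `f 3`, `f 3` and `f 1` remove the components of degrees `1`, `2` and `3` of a
central element; `f 1` produces all higher basis vectors. -/
theorem shift_center_le (S : Graded n c br) (hn : 6 ≤ n) (hc : ∀ i j, c j i = -c i j)
    (hc1 : ∀ i, 3 ≤ i → i + 1 ≤ n → c 1 i = 1) (hc2 : ∀ i, 3 ≤ i → i + 2 ≤ n → c 2 i = -1)
    (z : G) (hz : ∀ u, br u z = 0) : z ∈ Submodule.map₂ br ⊤ ⊤ := by
  have h2 : z ∈ S.F 2 := mem_succ_of_central (i := 3) (by omega) le_rfl (by omega)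
    (by rw [hc, hc1 3 le_rfl (by omega)]; simp) (hz _) (S.mem_F_one z)
  have h3 : z ∈ S.F 3 := mem_succ_of_central (i := 3) (by omega) (by omega) (by omega)
    (by rw [hc, hc2 3 le_rfl (by omega)]; simp) (hz _) h2
  have h4 : z ∈ S.F 4 := mem_succ_of_central (i := 1) (by omega) (by omega) (by omega)
    (by rw [hc1 3 le_rfl (by omega)]; simp) (hz _) h3
  refine S.F_le_map₂ ?_ h4
  intro i hi _ hin
  have := S.f_mem_map₂ (i := 1) (j := i - 1) (by omega) (by omega)
    (by rw [hc1 (i - 1) (by omega) (by omega)]; exact one_ne_zero)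
  rwa [show 1 + (i - 1) = i by omega] at this

/-- Weights add along `[f 3, f 4]`: with `a`, `b` the entries in degrees `1` and `3`, `4a + b = b +
(a + b)`. -/
theorem shift_proportional (S : Graded n c br) (hn : 7 ≤ n) (hc : ∀ i j, c j i = -c i j) (hc12 : c 1 2 = 0)
    (hc1 : ∀ i, 3 ≤ i → i + 1 ≤ n → c 1 i = 1) (hc2 : ∀ i, 3 ≤ i → i + 2 ≤ n → c 2 i = -1)
    (hc3 : c 3 4 ≠ 0) (hD : ∀ u v, D (br u v) = br (D u) v + br u (D v)) :
    S.ξ 3 (D (S.f 3)) = 3 * S.ξ 1 (D (S.f 1)) := by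
  have h := (shift_rankTwo (S := S) (by omega) hc hc12 hc1 hc2 D hD).weight_add hD (i := 3) (j := 4)
    (by omega) (by omega) (by omega) hc3
  norm_num [shiftP, shiftQ] at h
  linear_combination -h

end QuasiFiliform

/-! ### The Jacobi identity from structure constants. -/

section Jacobi

variable {G : Type*} [AddCommGroup G] [Module ℂ G] {br : G →ₗ[ℂ] G →ₗ[ℂ] G}
  {n : ℕ} {c : ℕ → ℕ → ℂ}

theorem isLie (S : Graded n c br) (halt : ∀ u, br u u = 0)
    (hJ : ∀ i j k, 1 ≤ i → 1 ≤ j → 1 ≤ k → i + j + k ≤ n →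
      c j k * c i (j + k) + c k i * c j (k + i) + c i j * c k (i + j) = 0) : IsLie br := by
  refine ⟨halt, ?_⟩
  have hf : ∀ i j k, 1 ≤ i → 1 ≤ j → 1 ≤ k →
      br (S.f i) (br (S.f j) (S.f k)) + br (S.f j) (br (S.f k) (S.f i))
        + br (S.f k) (br (S.f i) (S.f j)) = 0 := by
    intro i j k hi hj hk
    simp only [S.br_f _ _ hi hj, S.br_f _ _ hj hk, S.br_f _ _ hk hi, map_smul,
      S.br_f i (j + k) hi (by omega), S.br_f j (k + i) hj (by omega),
      S.br_f k (i + j) hk (by omega)]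
    rw [show j + (k + i) = i + (j + k) by omega, show k + (i + j) = i + (j + k) by omega]
    rcases lt_or_ge n (i + (j + k)) with hn | hn
    · simp [S.f_eq_zero _ hn]
    · rw [smul_smul, smul_smul, smul_smul, ← add_smul, ← add_smul,
        hJ i j k hi hj hk (by omega), zero_smul]
  have h1 : ∀ i j w, 1 ≤ i → 1 ≤ j →
      br (S.f i) (br (S.f j) w) + br (S.f j) (br w (S.f i)) + br w (br (S.f i) (S.f j)) = 0 := by
    intro i j w hi hj
    have : (br (S.f i)).comp (br (S.f j)) + (br (S.f j)).comp (br.flip (S.f i))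
        + br.flip (br (S.f i) (S.f j)) = 0 :=
      S.hom_ext fun k hk _ => by simpa using hf i j k hi hj hk
    exact LinearMap.congr_fun this w
  have h2 : ∀ i v w, 1 ≤ i →
      br (S.f i) (br v w) + br v (br w (S.f i)) + br w (br (S.f i) v) = 0 := by
    intro i v w hi
    have : (br (S.f i)).comp (br.flip w) + br.flip (br w (S.f i))
        + (br w).comp (br (S.f i)) = 0 :=
      S.hom_ext fun k hk _ => by simpa using h1 i k w hi hk
    exact LinearMap.congr_fun this v
  intro u v w
  have : br.flip (br v w) + (br v).comp (br w) + (br w).comp (br.flip v) = 0 :=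
    S.hom_ext fun k hk _ => by simpa using h2 k v w hk
  exact LinearMap.congr_fun this u

end Jacobi

end Graded

/-! ### From multiplication tables to graded bases. -/

section TableLemmas

/-- The vector of `ℂ^m` with the coordinates `t 1, …, t m`. -/
def restr (m : ℕ) (t : ℕ → ℂ) : Fin m → ℂ := fun k => t (k + 1)

/-- The basis vector `e_k` of `ℂ^m`, and zero if `k` is out of range. -/
def basisVec (m k : ℕ) : Fin m → ℂ := restr m (e k)

theorem basisVec_apply (m k : ℕ) (i : Fin m) :
    basisVec m k i = if (i : ℕ) + 1 = k then 1 else 0 := by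
  simp [basisVec, restr, e, Pi.single_apply]

theorem basisVec_eq_zero {m k : ℕ} (h : k = 0 ∨ m < k) : basisVec m k = 0 := by
  ext i
  rw [basisVec_apply, if_neg (by have := i.2; omega), Pi.zero_apply]

theorem ofTable_apply {m : ℕ} {T : ℕ → ℕ → ℕ → ℂ} (v w : Fin m → ℂ) (k : Fin m) :
    ofTable m T v w k = ∑ i : Fin m, ∑ j : Fin m,
      v i * w j * (T (i + 1) (j + 1) (k + 1) - T (j + 1) (i + 1) (k + 1)) := rfl

theorem ofTable_basisVec {m : ℕ} {T : ℕ → ℕ → ℕ → ℂ} {a b : ℕ} (ha : 1 ≤ a) (ham : a ≤ m)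
    (hb : 1 ≤ b) (hbm : b ≤ m) :
    ofTable m T (basisVec m a) (basisVec m b) = restr m (T a b - T b a) := by
  ext k
  rw [ofTable_apply, Finset.sum_eq_single ⟨a - 1, by omega⟩,
    Finset.sum_eq_single ⟨b - 1, by omega⟩]
  · simp [basisVec_apply, restr, Nat.sub_add_cancel ha, Nat.sub_add_cancel hb]
  · intro j _ hj
    rw [basisVec_apply m b, if_neg, mul_zero, zero_mul]
    exact fun h => hj (Fin.ext (by simp; omega))
  · simp
  · intro i _ hi
    refine Finset.sum_eq_zero fun j _ => ?_
    rw [basisVec_apply m a, if_neg, zero_mul, zero_mul]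
    exact fun h => hi (Fin.ext (by simp; omega))
  · simp

theorem ofTable_skew {m : ℕ} {T : ℕ → ℕ → ℕ → ℂ} (v w : Fin m → ℂ) :
    ofTable m T v w = -ofTable m T w v := by
  ext k
  rw [Pi.neg_apply, ofTable_apply, ofTable_apply, Finset.sum_comm, ← Finset.sum_neg_distrib]
  refine Finset.sum_congr rfl fun i _ => ?_
  rw [← Finset.sum_neg_distrib]
  exact Finset.sum_congr rfl fun j _ => by ring

theorem ofTable_self {m : ℕ} {T : ℕ → ℕ → ℕ → ℂ} (v : Fin m → ℂ) : ofTable m T v v = 0 := by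
  ext k
  exact self_eq_neg.1 (congrFun (ofTable_skew v v) k)

/-- The `k`-th coordinate on `ℂ^m`. -/
def coord (m k : ℕ) : (Fin m → ℂ) →ₗ[ℂ] ℂ :=
  if h : 1 ≤ k ∧ k ≤ m then LinearMap.proj ⟨k - 1, by omega⟩ else 0

theorem coord_apply {m : ℕ} (i : Fin m) (v : Fin m → ℂ) : coord m (i + 1) v = v i := by
  rw [coord, dif_pos ⟨by omega, by omega⟩]
  simp

theorem coord_basisVec {m k j : ℕ} (h1 : 1 ≤ k) (h2 : k ≤ m) :
    coord m k (basisVec m j) = if k = j then 1 else 0 := by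
  rw [coord, dif_pos ⟨h1, h2⟩, LinearMap.proj_apply, basisVec_apply, Nat.sub_add_cancel h1]

/-- The structure constants of the skew-symmetric bracket with half-table `s`. -/
def antisymm (s : ℕ → ℕ → ℂ) (i j : ℕ) : ℂ := s i j - s j i

theorem antisymm_swap (s : ℕ → ℕ → ℂ) (i j : ℕ) : antisymm s j i = -antisymm s i j := by
  rw [antisymm, antisymm, neg_sub]

/-- A numbering `σ` (with inverse `τ`) of the basis vectors of an algebra given by a table
that makes it graded. -/
def Graded.ofTable {n : ℕ} {T : ℕ → ℕ → ℕ → ℂ} (σ τ : ℕ → ℕ) (s : ℕ → ℕ → ℂ)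
    (hσ0 : ∀ i, i = 0 ∨ n < i → σ i = 0 ∨ n < σ i) (hσ : ∀ i, 1 ≤ i → i ≤ n → 1 ≤ σ i ∧ σ i ≤ n)
    (hτ : ∀ k, 1 ≤ k → k ≤ n → 1 ≤ τ k ∧ τ k ≤ n ∧ σ (τ k) = k)
    (hτσ : ∀ i, 1 ≤ i → i ≤ n → τ (σ i) = i)
    (hT : ∀ i j, 1 ≤ i → i ≤ n → 1 ≤ j → j ≤ n → T (σ i) (σ j) = s i j • e (σ (i + j))) :
    Graded n (antisymm s) (LeibnizAlg.ofTable n T) where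
  f i := basisVec n (σ i)
  ξ i := coord n (σ i)
  -- An index outside `1, …, n` names the zero vector, which encodes the vanishing of products of
  -- too high degree.
  f_eq_zero i hi := basisVec_eq_zero (hσ0 i (Or.inr hi))
  ξ_f i j hi hin := by
    rw [coord_basisVec (hσ i hi hin).1 (hσ i hi hin).2]
    by_cases h : i = j
    · simp [h]
    · rw [if_neg h, if_neg]
      intro h'
      by_cases hj : j = 0 ∨ n < j
      · have := hσ i hi hin
        rcases hσ0 j hj with h0 | h0 <;> omega
      · exact h (by rw [← hτσ i hi hin, ← hτσ j (by omega) (by omega), h'])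
  expand v := by
    ext k
    have hk := hτ (k + 1) (by omega) (by omega)
    rw [Finset.sum_apply, Finset.sum_eq_single (τ (k + 1))]
    · simp [hk.2.2, coord_apply, basisVec_apply]
    · intro i hi hne
      rw [Finset.mem_Icc] at hi
      rw [Pi.smul_apply, basisVec_apply, if_neg, smul_zero]
      intro h
      exact hne (by rw [h, hτσ i hi.1 hi.2])
    · intro h
      exact absurd (Finset.mem_Icc.2 ⟨hk.1, hk.2.1⟩) h
  br_f i j hi hj := by
    rcases lt_or_ge n i with hin | hin
    · rw [basisVec_eq_zero (hσ0 i (Or.inr hin)), basisVec_eq_zero (hσ0 (i + j) (Or.inr (by omega)))]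
      simp
    rcases lt_or_ge n j with hjn | hjn
    · rw [basisVec_eq_zero (hσ0 j (Or.inr hjn)), basisVec_eq_zero (hσ0 (i + j) (Or.inr (by omega)))]
      simp
    rw [ofTable_basisVec (hσ i hi hin).1 (hσ i hi hin).2 (hσ j hj hjn).1 (hσ j hj hjn).2,
      hT i j hi hin hj hjn, hT j i hj hjn hi hin, add_comm j i, ← sub_smul]
    rfl

/-- Extension by zero. -/
def extendZero (n : ℕ) : (Fin n → ℂ) →ₗ[ℂ] (Fin (n + 2) → ℂ) where
  toFun v k := if h : (k : ℕ) < n then v ⟨k, h⟩ else 0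
  map_add' v w := by
    ext k
    by_cases h : (k : ℕ) < n <;> simp [h]
  map_smul' a v := by
    ext k
    by_cases h : (k : ℕ) < n <;> simp [h]

theorem extendZero_apply {n : ℕ} (v : Fin n → ℂ) (k : Fin (n + 2)) :
    extendZero n v k = if h : (k : ℕ) < n then v ⟨k, h⟩ else 0 := rfl

theorem extendZero_restr {n : ℕ} {t : ℕ → ℂ} (h1 : t (n + 1) = 0) (h2 : t (n + 2) = 0) :
    extendZero n (restr n t) = restr (n + 2) t := by
  ext k
  rw [extendZero_apply]
  split_ifs with h
  · rfl
  · have : (k : ℕ) = n ∨ (k : ℕ) = n + 1 := by omega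
    rcases this with hk | hk
    · rw [restr, hk, h1]
    · rw [restr, hk, h2]

theorem extendZero_basisVec {n a : ℕ} (ha : a ≤ n) :
    extendZero n (basisVec n a) = basisVec (n + 2) a :=
  extendZero_restr (by simp [e, Pi.single_apply]; omega) (by simp [e, Pi.single_apply]; omega)

/-- The algebra given by a table extended by two diagonal operators is given by the table with
two more rows and columns. -/
theorem Graded.torusExt_isomorphic_ofTable {n : ℕ} {c : ℕ → ℕ → ℂ} {T T' : ℕ → ℕ → ℕ → ℂ}
    (S : Graded n c (LeibnizAlg.ofTable n T)) {σ : ℕ → ℕ} (hS : ∀ i, S.f i = basisVec n (σ i))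
    {p q : ℕ → ℂ} (hσ : ∀ i, 1 ≤ i → i ≤ n → 1 ≤ σ i ∧ σ i ≤ n)
    (hT : ∀ a b, a ≤ n → b ≤ n → T' a b = T a b)
    (hT1 : ∀ a b, a ≤ n → b ≤ n → T a b (n + 1) = 0)
    (hT2 : ∀ a b, a ≤ n → b ≤ n → T a b (n + 2) = 0)
    (hx : ∀ i, 1 ≤ i → i ≤ n → T' (σ i) (n + 1) = p i • e (σ i))
    (hy : ∀ i, 1 ≤ i → i ≤ n → T' (σ i) (n + 2) = q i • e (σ i))
    (hx0 : ∀ b, b ≤ n → T' (n + 1) b = 0) (hy0 : ∀ b, b ≤ n → T' (n + 2) b = 0)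
    (hxy : T' (n + 1) (n + 2) = 0) (hyx : T' (n + 2) (n + 1) = 0) :
    Isomorphic (torusExt (LeibnizAlg.ofTable n T) (S.diag p) (S.diag q))
      (LeibnizAlg.ofTable (n + 2) T') := by
  have hskew : ∀ v w, LeibnizAlg.ofTable (n + 2) T' v w = -LeibnizAlg.ofTable (n + 2) T' w v :=
    ofTable_skew
  have hself : ∀ v, LeibnizAlg.ofTable (n + 2) T' v v = 0 := ofTable_self
  set x := basisVec (n + 2) (n + 1) with hxdef
  set y := basisVec (n + 2) (n + 2) with hydef
  have hJf : ∀ i, 1 ≤ i → i ≤ n → extendZero n (S.f i) = basisVec (n + 2) (σ i) := by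
    intro i hi hin
    rw [hS, extendZero_basisVec (hσ i hi hin).2]
  have hJJ : ∀ u v, (LeibnizAlg.ofTable (n + 2) T') (extendZero n u) (extendZero n v) = extendZero n (LeibnizAlg.ofTable n T u v) := by
    intro u v
    have : (LeibnizAlg.ofTable (n + 2) T').compl₁₂ (extendZero n) (extendZero n) = (LeibnizAlg.ofTable n T).compr₂ (extendZero n) := by
      refine S.hom_ext₂ fun i j hi hin hj hjn => ?_
      have h1 := hσ i hi hin
      have h2 := hσ j hj hjn
      simp only [LinearMap.compl₁₂_apply, LinearMap.compr₂_apply]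
      rw [hJf i hi hin, hJf j hj hjn, hS, hS, ofTable_basisVec h1.1 h1.2 h2.1 h2.2,
        ofTable_basisVec h1.1 (by omega) h2.1 (by omega), hT _ _ h1.2 h2.2, hT _ _ h2.2 h1.2,
        extendZero_restr]
      · rw [Pi.sub_apply, hT1 _ _ h1.2 h2.2, hT1 _ _ h2.2 h1.2, sub_zero]
      · rw [Pi.sub_apply, hT2 _ _ h1.2 h2.2, hT2 _ _ h2.2 h1.2, sub_zero]
    simpa using LinearMap.congr_fun₂ this u v
  have hJx : ∀ u, (LeibnizAlg.ofTable (n + 2) T') (extendZero n u) x = extendZero n (S.diag p u) := by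
    intro u
    have : ((LeibnizAlg.ofTable (n + 2) T').flip x).comp (extendZero n) = (extendZero n).comp (S.diag p) := by
      refine S.hom_ext fun i hi hin => ?_
      have h1 := hσ i hi hin
      rw [LinearMap.comp_apply, LinearMap.comp_apply, LinearMap.flip_apply, S.diag_f p hi,
        map_smul, hJf i hi hin, hxdef,
        ofTable_basisVec h1.1 (by omega) (by omega) (by omega), hx i hi hin, hx0 _ h1.2, sub_zero]
      rfl
    exact LinearMap.congr_fun this u
  have hJy : ∀ u, (LeibnizAlg.ofTable (n + 2) T') (extendZero n u) y = extendZero n (S.diag q u) := by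
    intro u
    have : ((LeibnizAlg.ofTable (n + 2) T').flip y).comp (extendZero n) = (extendZero n).comp (S.diag q) := by
      refine S.hom_ext fun i hi hin => ?_
      have h1 := hσ i hi hin
      rw [LinearMap.comp_apply, LinearMap.comp_apply, LinearMap.flip_apply, S.diag_f q hi,
        map_smul, hJf i hi hin, hydef,
        ofTable_basisVec h1.1 (by omega) (by omega) (by omega), hy i hi hin, hy0 _ h1.2, sub_zero]
      rfl
    exact LinearMap.congr_fun this u
  have hxy' : (LeibnizAlg.ofTable (n + 2) T') x y = 0 := by
    rw [hxdef, hydef, ofTable_basisVec (by omega) (by omega) (by omega) (by omega), hxy,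
      hyx, sub_zero]
    rfl
  let Ψ : ((Fin n → ℂ) × ℂ × ℂ) →ₗ[ℂ] (Fin (n + 2) → ℂ) := (extendZero n).coprod
    ((LinearMap.toSpanSingleton ℂ _ x).coprod (LinearMap.toSpanSingleton ℂ _ y))
  have hΨ : ∀ u, Ψ u = extendZero n u.1 + (u.2.1 • x + u.2.2 • y) := fun u => rfl
  have hinj : Function.Injective Ψ := by
    rw [injective_iff_map_eq_zero]
    rintro ⟨v, a, b⟩ h
    rw [hΨ] at h
    have ha := congrFun h ⟨n, by omega⟩
    have hb := congrFun h ⟨n + 1, by omega⟩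
    simp [extendZero_apply, hxdef, hydef, basisVec_apply] at ha hb
    have hv : v = 0 := by
      ext k
      have hk := congrFun h ⟨k, by omega⟩
      simpa [extendZero_apply, ha, hb] using hk
    rw [hv, ha, hb]
    rfl
  refine ⟨LinearEquiv.ofInjectiveOfFinrankEq Ψ hinj (by simp), ?_⟩
  intro u v
  change Ψ _ = LeibnizAlg.ofTable (n + 2) T' (Ψ u) (Ψ v)
  rw [hΨ, hΨ, hΨ, torusExt_apply]
  simp only [map_add, map_sub, map_smul, LinearMap.add_apply, LinearMap.smul_apply, hJJ, hJx, hJy,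
    hskew x (extendZero n v.1), hskew y (extendZero n v.1), hxy', hskew y x, hself, Prod.fst_zero, Prod.snd_zero, zero_smul, smul_zero]
  module

end TableLemmas

open LeibnizAlg.Graded

section StandardNumbering

/-- Tables with `T i j` a multiple of `e (i + j)`. -/
def gradedOfTable (n : ℕ) (T : ℕ → ℕ → ℕ → ℂ) (s : ℕ → ℕ → ℂ)
    (hT : ∀ i j, T i j = s i j • e (i + j)) :
    Graded n (antisymm s) (ofTable n T) :=
  Graded.ofTable id id s (fun _ h => h) (fun _ h h' => ⟨h, h'⟩) (fun _ h h' => ⟨h, h', rfl⟩)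
    (fun _ _ _ => rfl) (fun i j _ _ _ _ => hT i j)

/-- The numbering `e_1, e_n, e_2, …, e_{n-1}`. -/
def shiftIndex (n i : ℕ) : ℕ :=
  -- The default value `0` names no basis vector, so degrees above `n` give zero.
  if i = 1 then 1 else if i = 2 then n else if i ≤ n then i - 1 else 0

theorem shiftIndex_cases {n i : ℕ} :
    (i = 1 ∧ shiftIndex n i = 1) ∨ (i = 2 ∧ shiftIndex n i = n) ∨
      (i ≠ 1 ∧ i ≠ 2 ∧ i ≤ n ∧ shiftIndex n i = i - 1) ∨
      (i ≠ 1 ∧ i ≠ 2 ∧ n < i ∧ shiftIndex n i = 0) := by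
  unfold shiftIndex
  split_ifs <;> omega

def gradedOfTableShift (n : ℕ) (hn : 3 ≤ n) (T : ℕ → ℕ → ℕ → ℂ) (s : ℕ → ℕ → ℂ)
    (hT : ∀ i j, 1 ≤ i → i ≤ n → 1 ≤ j → j ≤ n →
      T (shiftIndex n i) (shiftIndex n j) = s i j • e (shiftIndex n (i + j))) :
    Graded n (antisymm s) (ofTable n T) :=
  Graded.ofTable (shiftIndex n) (fun k => if k = 1 then 1 else if k = n then 2 else k + 1) s
    (by intro i hi; unfold shiftIndex; split_ifs <;> omega)
    (by intro i hi hin; unfold shiftIndex; split_ifs <;> omega)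
    (by intro k hk hkn; unfold shiftIndex; split_ifs <;> omega)
    (by intro i hi hin; unfold shiftIndex; split_ifs <;> omega) hT

end StandardNumbering

/-! ### The family of `g1`. -/

section FirstFamily

def coeffG1 (n i j : ℕ) : ℂ :=
  if i = 1 ∧ 2 ≤ j ∧ j + 2 ≤ n then 1
  else if 2 ≤ i ∧ 2 * i + 1 ≤ n ∧ i + j = n then (-1 : ℂ) ^ i
  else 0

theorem tableG1_eq (n i j : ℕ) : tableG1 n i j = coeffG1 n i j • e (i + j) := by
  unfold tableG1 coeffG1
  split_ifs with h1 h2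
  · rw [one_smul, h1.1, add_comm]
  · rw [h2.2.2]
  · rw [zero_smul]

def gradedG1 (n : ℕ) : Graded n (antisymm (coeffG1 n)) (g1 n) :=
  gradedOfTable n (tableG1 n) (coeffG1 n) (tableG1_eq n)

variable {n : ℕ}

theorem coeffG1_one {j : ℕ} (hj : 2 ≤ j) (hjn : j + 2 ≤ n) : antisymm (coeffG1 n) 1 j = 1 := by
  rw [antisymm, coeffG1, coeffG1, if_pos ⟨rfl, hj, hjn⟩, if_neg (by omega), if_neg (by omega),
    sub_zero]

theorem neg_one_pow_of_add_odd {i j : ℕ} (h : Odd (i + j)) : (-1 : ℂ) ^ i = -(-1) ^ j := by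
  rcases Nat.even_or_odd j with hj | hj
  · rw [hj.neg_one_pow, ((Nat.odd_add.1 h).2 hj).neg_one_pow]
  · rw [hj.neg_one_pow, ((Nat.odd_add'.1 h).1 hj).neg_one_pow, neg_neg]

/-- The table lists only `i < n - i`. The other half comes from skew-symmetry with the same sign
rule, since `i` and `n - i` have opposite parity. -/
theorem coeffG1_compl (hodd : Odd n) {i j : ℕ} (hi : 2 ≤ i) (hj : 2 ≤ j) (hij : i + j = n) :
    antisymm (coeffG1 n) i j = (-1) ^ i := by
  have hodd' := hodd
  obtain ⟨m, hm⟩ := hodd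
  rcases lt_or_ge i j with h | h
  · rw [antisymm, coeffG1, coeffG1, if_neg (by omega), if_pos (by omega), if_neg (by omega),
      if_neg (by omega), sub_zero]
  · rw [antisymm, coeffG1, coeffG1, if_neg (by omega), if_neg (by omega), if_neg (by omega),
      if_pos (by omega), zero_sub, neg_one_pow_of_add_odd (i := i) (j := j) (by rwa [hij])]

theorem coeffG1_mid {i j : ℕ} (hi : 2 ≤ i) (hj : 2 ≤ j) (hij : i + j ≠ n) :
    antisymm (coeffG1 n) i j = 0 := by
  rw [antisymm, coeffG1, coeffG1, if_neg (by omega), if_neg (by omega), if_neg (by omega),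
    if_neg (by omega), sub_zero]

theorem antisymm_self (s : ℕ → ℕ → ℂ) (i : ℕ) : antisymm s i i = 0 := sub_self _

/-- Two indices equal to `1` cancel by skew-symmetry, and none gives only zero terms. With one such
index and `j, k ≥ 2`, the surviving terms occur when `1 + j + k = n` and cancel because `j` and `k`
have equal parity. -/
theorem jacobi_coeffG1 (hodd : Odd n) (i j k : ℕ) (hi : 1 ≤ i) (hj : 1 ≤ j) (hk : 1 ≤ k)
    (h : i + j + k ≤ n) :
    antisymm (coeffG1 n) j k * antisymm (coeffG1 n) i (j + k)
      + antisymm (coeffG1 n) k i * antisymm (coeffG1 n) j (k + i)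
      + antisymm (coeffG1 n) i j * antisymm (coeffG1 n) k (i + j) = 0 := by
  have h11 : ∀ k, antisymm (coeffG1 n) 1 k * antisymm (coeffG1 n) 1 (1 + k)
      + antisymm (coeffG1 n) k 1 * antisymm (coeffG1 n) 1 (k + 1)
      + antisymm (coeffG1 n) 1 1 * antisymm (coeffG1 n) k (1 + 1) = 0 := by
    intro k
    rw [antisymm_self, antisymm_swap _ 1 k, add_comm k 1]
    ring
  have h1 : ∀ j k, 2 ≤ j → 2 ≤ k → 1 + j + k ≤ n →
      antisymm (coeffG1 n) j k * antisymm (coeffG1 n) 1 (j + k)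
        + antisymm (coeffG1 n) k 1 * antisymm (coeffG1 n) j (k + 1)
        + antisymm (coeffG1 n) 1 j * antisymm (coeffG1 n) k (1 + j) = 0 := by
    intro j k hj hk h
    rw [coeffG1_mid hj hk (by omega), antisymm_swap _ 1 k, coeffG1_one hk (by omega),
      coeffG1_one hj (by omega)]
    by_cases hjk : 1 + j + k = n
    · rw [coeffG1_compl hodd hj (by omega) (by omega), coeffG1_compl hodd hk (by omega) (by omega),
        neg_one_pow_of_add_odd (i := k) (j := j + 1) (by convert hodd using 1; omega)]
      ring
    · rw [coeffG1_mid hj (by omega) (by omega), coeffG1_mid hk (by omega) (by omega)]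
      ring
  rcases eq_or_ne i 1 with rfl | hi1 <;> rcases eq_or_ne j 1 with rfl | hj1 <;>
    rcases eq_or_ne k 1 with rfl | hk1
  · exact h11 1
  · exact h11 k
  · linear_combination h11 j
  · exact h1 j k (by omega) (by omega) h
  · linear_combination h11 i
  · linear_combination h1 k i (by omega) (by omega) (by omega)
  · linear_combination h1 i j (by omega) (by omega) (by omega)
  · rw [coeffG1_mid (i := j) (j := k) (by omega) (by omega) (by omega),
      coeffG1_mid (i := k) (j := i) (by omega) (by omega) (by omega),
      coeffG1_mid (i := i) (j := j) (by omega) (by omega) (by omega)]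
    ring

theorem coeffG1_ne_zero (hn : 6 ≤ n) {i j : ℕ} (hi : 1 ≤ i) (hj : 1 ≤ j) (hij : i + j ≤ n)
    (h : antisymm (coeffG1 n) i j ≠ 0) :
    (i = 1 ∧ 2 ≤ j ∧ j + 2 ≤ n) ∨ (j = 1 ∧ 2 ≤ i ∧ i + 2 ≤ n) ∨ (2 ≤ i ∧ 2 ≤ j ∧ i + j = n) := by
  by_contra hcon
  apply h
  unfold antisymm coeffG1
  rw [if_neg (by omega), if_neg (by omega), if_neg (by omega), if_neg (by omega), sub_zero]

theorem coeffG1_eq_zero {i j : ℕ} (hi : 1 ≤ i) (hj : 1 ≤ j) (hij : i + j < n)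
    (h : antisymm (coeffG1 n) i j = 0) : (i = 1 ∧ j = 1) ∨ (2 ≤ i ∧ 2 ≤ j) := by
  rcases eq_or_ne i 1 with rfl | hi1 <;> rcases eq_or_ne j 1 with rfl | hj1
  · exact Or.inl ⟨rfl, rfl⟩
  · rw [coeffG1_one (by omega) (by omega)] at h
    exact absurd h one_ne_zero
  · rw [antisymm_swap, coeffG1_one (by omega) (by omega)] at h
    exact absurd h (neg_ne_zero.2 one_ne_zero)
  · exact Or.inr ⟨by omega, by omega⟩

/-- The weights `p + n q`, shifted to be natural numbers. -/
def filiformWeight (n i : ℕ) : ℕ := if i = n then 3 * n else if i = 1 then 5 else i + n + 2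

theorem filiformWeight_spec (n i : ℕ) :
    filiformP n i + n * filiformQ n i = (filiformWeight n i : ℂ) - 4 := by
  unfold filiformP filiformQ filiformWeight
  split_ifs <;> push_cast <;> ring

theorem filiformP_additive (hn : 6 ≤ n) : WeightAdditive n (antisymm (coeffG1 n)) (filiformP n) := by
  intro i j hi hj hij hc
  rcases coeffG1_ne_zero hn hi hj hij hc with h | h | h
  · unfold filiformP
    rw [if_neg (by omega), if_neg (by omega), if_neg (by omega), if_pos h.1, if_neg (by omega),
      if_neg (by omega), h.1]
    push_cast
    ring
  · unfold filiformP
    rw [if_neg (by omega), if_neg (by omega), if_neg (by omega), if_neg (by omega),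
      if_neg (by omega), if_pos h.1, h.1]
    push_cast
    ring
  · unfold filiformP
    rw [if_pos h.2.2, if_neg (by omega), if_neg (by omega), if_neg (by omega), if_neg (by omega),
      ← h.2.2]
    push_cast
    ring

theorem filiformQ_additive (hn : 6 ≤ n) : WeightAdditive n (antisymm (coeffG1 n)) (filiformQ n) := by
  intro i j hi hj hij hc
  rcases coeffG1_ne_zero hn hi hj hij hc with h | h | h
  · unfold filiformQ
    rw [if_neg (by omega), if_neg (by omega), if_neg (by omega), if_pos h.1, if_neg (by omega),
      if_neg (by omega)]
    ring
  · unfold filiformQ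
    rw [if_neg (by omega), if_neg (by omega), if_neg (by omega), if_neg (by omega),
      if_neg (by omega), if_pos h.1]
    ring
  · unfold filiformQ
    rw [if_pos h.2.2, if_neg (by omega), if_neg (by omega), if_neg (by omega), if_neg (by omega)]
    ring

/-- The weights are `1` in degree `1`, then `n, …, 2n - 3`, and `3n - 4` in degree `n`. Two middle
weights sum to `2n + i + j - 4`, too large for a middle weight and equal to the last one only if `i
+ j = n`; the sum `1 + 1` is not a weight. -/
theorem filiform_generic (hn : 6 ≤ n) : WeightGeneric n (antisymm (coeffG1 n))
    (fun i => filiformP n i + n * filiformQ n i) := by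
  intro i j k hi hj hc hk hkn h
  simp only [filiformWeight_spec] at h
  have h1 : filiformWeight n k + 4 = filiformWeight n i + filiformWeight n j := by
    have : ((filiformWeight n k + 4 : ℕ) : ℂ) = (filiformWeight n i + filiformWeight n j : ℕ) := by
      push_cast
      linear_combination h
    exact_mod_cast this
  unfold filiformWeight at h1
  rcases coeffG1_eq_zero hi hj (by omega) hc with h2 | h2 <;> split_ifs at h1 <;> omega

theorem torusExt_g1_isomorphic (hn : 6 ≤ n) :
    Isomorphic (torusExt (g1 n) ((gradedG1 n).diag (filiformP n))
      ((gradedG1 n).diag (filiformQ n))) (R1 n) := by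
  refine (gradedG1 n).torusExt_isomorphic_ofTable (σ := id) (fun _ => rfl)
    (fun i hi hin => ⟨hi, hin⟩) ?_ ?_ ?_ ?_ ?_ ?_ ?_ ?_ ?_
  · intro a b _ hb
    rw [tableR1, if_neg (by omega), if_neg (by omega)]
  · intro a b ha hb
    unfold tableG1
    split_ifs <;> simp [e, Pi.single_apply]
    all_goals omega
  · intro a b ha hb
    unfold tableG1
    split_ifs <;> simp [e, Pi.single_apply]
    all_goals omega
  · intro i hi hin
    simp only [id]
    rcases eq_or_ne i n with rfl | hne
    · rw [tableR1, if_pos rfl, if_neg (by omega), if_neg (by omega), if_pos rfl, filiformP,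
        if_pos rfl]
    rcases eq_or_ne i 1 with rfl | hne1
    · rw [tableR1, if_pos rfl, if_pos rfl, filiformP, if_neg hne, if_pos rfl, one_smul]
    · rw [tableR1, if_pos rfl, if_neg hne1, if_pos (by omega), filiformP, if_neg hne, if_neg hne1]
  · intro i hi hin
    simp only [id]
    rcases eq_or_ne i n with rfl | hne
    · rw [tableR1, if_neg (by omega), if_pos rfl, if_neg (by omega), if_pos rfl, filiformQ,
        if_pos rfl]
    rcases eq_or_ne i 1 with rfl | hne1
    · rw [tableR1, if_neg (by omega), if_pos rfl, if_neg (by omega), if_neg hne, filiformQ,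
        if_neg hne, if_pos rfl, zero_smul]
    · rw [tableR1, if_neg (by omega), if_pos rfl, if_pos (by omega), filiformQ, if_neg hne,
        if_neg hne1, one_smul]
  · intro b hb
    rw [tableR1, if_neg (by omega), if_neg (by omega), tableG1, if_neg (by omega),
      if_neg (by omega)]
  · intro b hb
    rw [tableR1, if_neg (by omega), if_neg (by omega), tableG1, if_neg (by omega),
      if_neg (by omega)]
  · rw [tableR1, if_neg (by omega), if_pos rfl, if_neg (by omega), if_neg (by omega)]
  · rw [tableR1, if_pos rfl, if_neg (by omega), if_neg (by omega), if_neg (by omega)]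

theorem g1_isLie (hodd : Odd n) : IsLie (g1 n) :=
  (gradedG1 n).isLie ofTable_self (jacobi_coeffG1 hodd)

theorem torusExt_g1_isLie (hn : 6 ≤ n) (hodd : Odd n) :
    IsLie (torusExt (g1 n) ((gradedG1 n).diag (filiformP n)) ((gradedG1 n).diag (filiformQ n))) :=
  torusExt_isLie (g1_isLie hodd) ((gradedG1 n).diag_br (filiformP_additive hn))
    ((gradedG1 n).diag_br (filiformQ_additive hn)) ((gradedG1 n).diag_comm _ _)

theorem R1_isLie (hn : 6 ≤ n) (hodd : Odd n) : IsLie (R1 n) :=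
  (torusExt_g1_isLie hn hodd).congr (torusExt_g1_isomorphic hn)

theorem R1_inFamily (hn : 6 ≤ n) (hodd : Odd n) : InFamily (g1 n) 2 (R1 n) := by
  refine InFamily.congr (torusExt_g1_isomorphic hn) ((gradedG1 n).torusExt_inFamily (g := 2)
    (by omega) (by omega) (by omega) ?_ ?_ ?_ ?_ (torusExt_g1_isLie hn hodd))
  · rw [filiformP, if_neg (by omega), if_pos rfl]
  · rw [filiformQ, if_neg (by omega), if_pos rfl]
  · rw [filiformP, if_neg (by omega), if_neg (by omega)]
    norm_num
  · rw [filiformQ, if_neg (by omega), if_neg (by omega)]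

theorem isomorphic_R1 (hn : 6 ≤ n) (hodd : Odd n) {R : Type*} [AddCommGroup R] [Module ℂ R]
    {br : R →ₗ[ℂ] R →ₗ[ℂ] R} (h : InFamily (g1 n) 2 br) : Isomorphic br (R1 n) := by
  have hc2 : antisymm (coeffG1 n) 2 (n - 2) ≠ 0 := by
    rw [coeffG1_compl hodd le_rfl (by omega) (by omega)]
    norm_num
  have hw : ∀ i k, filiformWeight n k ≠ filiformWeight n i →
      filiformP n k + n * filiformQ n k ≠ filiformP n i + n * filiformQ n i := by
    intro i k hne h
    rw [filiformWeight_spec, filiformWeight_spec, sub_left_inj] at h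
    exact hne (by exact_mod_cast h)
  refine Isomorphic.trans (Graded.RankTwo.isomorphic_torusExt (S := gradedG1 n) (g := 2)
    (filiform_rankTwo hn (antisymm_swap _) (fun i => coeffG1_one) hc2) (by omega) (by omega)
    (by omega) ofTable_skew
    (filiform_center_le (gradedG1 n) hn (antisymm_swap _) (fun i => coeffG1_one) hc2)
    (filiformP_additive hn) (filiformQ_additive hn) n ?_ ?_ (filiform_generic hn) h)
    (torusExt_g1_isomorphic hn)
  · intro i hi hin h
    rw [filiformWeight_spec, sub_eq_zero] at h
    have h1 : filiformWeight n i = 4 := by exact_mod_cast h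
    unfold filiformWeight at h1
    split_ifs at h1 <;> omega
  · intro i k hi hik hkn
    apply hw
    unfold filiformWeight
    split_ifs <;> omega

end FirstFamily

/-! ### The families of `g2` and `g3`. -/

section SecondFamily

/-- In the order of `shiftIndex` the vector `e_n` has degree `2` and `e_i` has degree `i + 1` for `2
≤ i ≤ n - 1`; this moves the ranges of the table by one. -/
def coeffG2 (n i j : ℕ) : ℂ :=
  if i = 1 ∧ 3 ≤ j ∧ j + 1 ≤ n then 1
  else if 3 ≤ i ∧ i + 2 ≤ n ∧ j = 2 then 1
  else 0

def coeffG3 (n i j : ℕ) : ℂ :=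
  if i = 1 ∧ 3 ≤ j ∧ j + 1 ≤ n then 1
  else if 3 ≤ i ∧ i + 2 ≤ n ∧ j = 2 then 1
  else if i = 3 ∧ 4 ≤ j ∧ j + 3 ≤ n then 1
  else 0

theorem tableG2_eq {n : ℕ} (hn : 6 ≤ n) (i j : ℕ) (hi : 1 ≤ i) (hin : i ≤ n) (hj : 1 ≤ j)
    (hjn : j ≤ n) : tableG2 n (shiftIndex n i) (shiftIndex n j) =
      coeffG2 n i j • e (shiftIndex n (i + j)) := by
  have h1 := @shiftIndex_cases n i
  have h2 := @shiftIndex_cases n j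
  have h3 := @shiftIndex_cases n (i + j)
  generalize shiftIndex n i = a at *
  generalize shiftIndex n j = b at *
  generalize shiftIndex n (i + j) = c at *
  unfold tableG2 coeffG2
  split_ifs <;> first
    | (exfalso; omega)
    | (rw [one_smul]; congr 1; omega)
    | rw [zero_smul]

theorem tableG3_eq {n : ℕ} (hn : 6 ≤ n) (i j : ℕ) (hi : 1 ≤ i) (hin : i ≤ n) (hj : 1 ≤ j)
    (hjn : j ≤ n) : tableG3 n (shiftIndex n i) (shiftIndex n j) =
      coeffG3 n i j • e (shiftIndex n (i + j)) := by
  have h1 := @shiftIndex_cases n i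
  have h2 := @shiftIndex_cases n j
  have h3 := @shiftIndex_cases n (i + j)
  generalize shiftIndex n i = a at *
  generalize shiftIndex n j = b at *
  generalize shiftIndex n (i + j) = c at *
  unfold tableG3 coeffG3
  split_ifs <;> first
    | (exfalso; omega)
    | (rw [one_smul]; congr 1; omega)
    | rw [zero_smul]

def gradedG2 (n : ℕ) (hn : 6 ≤ n) : Graded n (antisymm (coeffG2 n)) (g2 n) :=
  gradedOfTableShift n (by omega) (tableG2 n) (coeffG2 n) (tableG2_eq hn)

def gradedG3 (n : ℕ) (hn : 6 ≤ n) : Graded n (antisymm (coeffG3 n)) (g3 n) :=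
  gradedOfTableShift n (by omega) (tableG3 n) (coeffG3 n) (tableG3_eq hn)

variable {n : ℕ}

theorem coeffG3_one {j : ℕ} (hj : 3 ≤ j) (hjn : j + 1 ≤ n) : antisymm (coeffG3 n) 1 j = 1 := by
  rw [antisymm, coeffG3, coeffG3, if_pos ⟨rfl, hj, hjn⟩, if_neg (by omega), if_neg (by omega),
    if_neg (by omega), sub_zero]

theorem coeffG3_two {j : ℕ} (hj : 3 ≤ j) (hjn : j + 2 ≤ n) : antisymm (coeffG3 n) 2 j = -1 := by
  rw [antisymm, coeffG3, coeffG3, if_neg (by omega), if_neg (by omega), if_neg (by omega),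
    if_neg (by omega), if_pos ⟨hj, hjn, rfl⟩, zero_sub]

theorem coeffG3_one_two : antisymm (coeffG3 n) 1 2 = 0 := by
  rw [antisymm, coeffG3, coeffG3, if_neg (by omega), if_neg (by omega), if_neg (by omega),
    if_neg (by omega), if_neg (by omega), if_neg (by omega), sub_zero]

theorem coeffG3_three_four (hn : 7 ≤ n) : antisymm (coeffG3 n) 3 4 ≠ 0 := by
  rw [antisymm, coeffG3, coeffG3, if_neg (by omega), if_neg (by omega), if_pos (by omega),
    if_neg (by omega), if_neg (by omega), if_neg (by omega), sub_zero]
  exact one_ne_zero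

theorem not_inFamily_g3 (hn : 7 ≤ n) {R : Type*} [AddCommGroup R] [Module ℂ R]
    {br : R →ₗ[ℂ] R →ₗ[ℂ] R} : ¬ InFamily (g3 n) 2 br := by
  have hn' : 6 ≤ n := by omega
  refine (Graded.shift_rankTwo (S := gradedG3 n hn') hn' (antisymm_swap _) coeffG3_one_two
    (fun i => coeffG3_one) (fun i => coeffG3_two)).not_inFamily_of_proportional (by omega)
    (by omega) (by omega) 3 fun D hD => ?_
  exact Graded.shift_proportional (gradedG3 n hn') hn (antisymm_swap _) coeffG3_one_two
    (fun i => coeffG3_one) (fun i => coeffG3_two) (coeffG3_three_four hn) hD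

theorem coeffG2_one {j : ℕ} (hj : 3 ≤ j) (hjn : j + 1 ≤ n) : antisymm (coeffG2 n) 1 j = 1 := by
  rw [antisymm, coeffG2, coeffG2, if_pos ⟨rfl, hj, hjn⟩, if_neg (by omega), if_neg (by omega),
    sub_zero]

theorem coeffG2_two {j : ℕ} (hj : 3 ≤ j) (hjn : j + 2 ≤ n) : antisymm (coeffG2 n) 2 j = -1 := by
  rw [antisymm, coeffG2, coeffG2, if_neg (by omega), if_neg (by omega),
    if_neg (by omega), if_pos ⟨hj, hjn, rfl⟩, zero_sub]

theorem coeffG2_low {i j : ℕ} (hi : i ≤ 2) (hj : j ≤ 2) : antisymm (coeffG2 n) i j = 0 := by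
  rw [antisymm, coeffG2, coeffG2, if_neg (by omega), if_neg (by omega), if_neg (by omega),
    if_neg (by omega), sub_zero]

theorem coeffG2_high {i j : ℕ} (hi : 3 ≤ i) (hj : 3 ≤ j) : antisymm (coeffG2 n) i j = 0 := by
  rw [antisymm, coeffG2, coeffG2, if_neg (by omega), if_neg (by omega), if_neg (by omega),
    if_neg (by omega), sub_zero]

/-- The span of `f 3, …, f n` is an abelian ideal on which `f 1` and `f 2` act by a shift and minus
its square. These operators commute, as do `f 1` and `f 2`. -/
theorem jacobi_coeffG2 (i j k : ℕ) (hi : 1 ≤ i) (hj : 1 ≤ j) (hk : 1 ≤ k) (h : i + j + k ≤ n) :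
    antisymm (coeffG2 n) j k * antisymm (coeffG2 n) i (j + k)
      + antisymm (coeffG2 n) k i * antisymm (coeffG2 n) j (k + i)
      + antisymm (coeffG2 n) i j * antisymm (coeffG2 n) k (i + j) = 0 := by
  have hε : ∀ i, 1 ≤ i → i ≤ 2 → ∃ ε : ℂ, ∀ m, 3 ≤ m → i + m ≤ n →
      antisymm (coeffG2 n) i m = ε := by
    intro i hi hi2
    rcases (by omega : i = 1 ∨ i = 2) with rfl | rfl
    · exact ⟨1, fun m hm hmn => coeffG2_one hm (by omega)⟩
    · exact ⟨-1, fun m hm hmn => coeffG2_two hm (by omega)⟩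
  have h2 : ∀ i j k, 1 ≤ i → i ≤ 2 → 1 ≤ j → j ≤ 2 → 3 ≤ k → i + j + k ≤ n →
      antisymm (coeffG2 n) j k * antisymm (coeffG2 n) i (j + k)
      + antisymm (coeffG2 n) k i * antisymm (coeffG2 n) j (k + i)
      + antisymm (coeffG2 n) i j * antisymm (coeffG2 n) k (i + j) = 0 := by
    intro i j k hi hi2 hj hj2 hk h
    obtain ⟨ε, hε1⟩ := hε i hi hi2
    obtain ⟨δ, hδ1⟩ := hε j hj hj2
    rw [coeffG2_low hi2 hj2, antisymm_swap _ i k, hε1 k hk (by omega), hδ1 k hk (by omega),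
      hε1 (j + k) (by omega) (by omega), hδ1 (k + i) (by omega) (by omega)]
    ring
  have h1 : ∀ i j k, 3 ≤ j → 3 ≤ k →
      antisymm (coeffG2 n) j k * antisymm (coeffG2 n) i (j + k)
      + antisymm (coeffG2 n) k i * antisymm (coeffG2 n) j (k + i)
      + antisymm (coeffG2 n) i j * antisymm (coeffG2 n) k (i + j) = 0 := by
    intro i j k hj hk
    rw [coeffG2_high hj hk, coeffG2_high hj (show 3 ≤ k + i by omega),
      coeffG2_high hk (show 3 ≤ i + j by omega)]
    ring
  rcases le_or_gt i 2 with hi2 | hi2 <;> rcases le_or_gt j 2 with hj2 | hj2 <;>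
    rcases le_or_gt k 2 with hk2 | hk2
  · rw [coeffG2_low hj2 hk2, coeffG2_low hk2 hi2, coeffG2_low hi2 hj2]
    ring
  · exact h2 i j k hi hi2 hj hj2 hk2 h
  · linear_combination h2 k i j hk hk2 hi hi2 hj2 (by omega)
  · exact h1 i j k hj2 hk2
  · linear_combination h2 j k i hj hj2 hk hk2 hi2 (by omega)
  · linear_combination h1 j k i hk2 hi2
  · linear_combination h1 k i j hi2 hj2
  · exact h1 i j k hj2 hk2

theorem coeffG2_ne_zero {i j : ℕ} (h : antisymm (coeffG2 n) i j ≠ 0) :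
    (i ≤ 2 ∧ 3 ≤ j) ∨ (3 ≤ i ∧ j ≤ 2) := by
  by_contra hcon
  rcases (by omega : (i ≤ 2 ∧ j ≤ 2) ∨ (3 ≤ i ∧ 3 ≤ j)) with h' | h'
  · exact h (coeffG2_low h'.1 h'.2)
  · exact h (coeffG2_high h'.1 h'.2)

theorem coeffG2_eq_zero {i j : ℕ} (hi : 1 ≤ i) (hj : 1 ≤ j) (hij : i + j ≤ n)
    (h : antisymm (coeffG2 n) i j = 0) : (i ≤ 2 ∧ j ≤ 2) ∨ (3 ≤ i ∧ 3 ≤ j) := by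
  by_contra hcon
  rcases (by omega : (i = 1 ∧ 3 ≤ j) ∨ (i = 2 ∧ 3 ≤ j) ∨ (3 ≤ i ∧ j = 1) ∨ (3 ≤ i ∧ j = 2))
    with ⟨rfl, h'⟩ | ⟨rfl, h'⟩ | ⟨h', rfl⟩ | ⟨h', rfl⟩
  · simp [coeffG2_one h' (show j + 1 ≤ n by omega)] at h
  · simp [coeffG2_two h' (show j + 2 ≤ n by omega)] at h
  · simp [antisymm_swap _ 1 i, coeffG2_one h' (show i + 1 ≤ n by omega)] at h
  · simp [antisymm_swap _ 2 i, coeffG2_two h' (show i + 2 ≤ n by omega)] at h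

/-- The weights `p + n q`, shifted to be natural numbers. -/
def shiftWeight (n i : ℕ) : ℕ := if i = 1 then 5 else if i = 2 then 6 else i + n + 1

theorem shiftWeight_spec (n i : ℕ) :
    shiftP i + n * shiftQ i = (shiftWeight n i : ℂ) - 4 := by
  unfold shiftP shiftQ shiftWeight
  split_ifs <;> push_cast <;> ring

theorem shiftP_additive : WeightAdditive n (antisymm (coeffG2 n)) shiftP := by
  intro i j hi hj hij hc
  rcases (by have := coeffG2_ne_zero hc; omega :
    (i = 1 ∧ 3 ≤ j) ∨ (i = 2 ∧ 3 ≤ j) ∨ (3 ≤ i ∧ j = 1) ∨ (3 ≤ i ∧ j = 2))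
    with ⟨rfl, h⟩ | ⟨rfl, h⟩ | ⟨h, rfl⟩ | ⟨h, rfl⟩
  all_goals
    unfold shiftP
    split_ifs <;> first
      | (exfalso; omega)
      | (push_cast; ring)

theorem shiftQ_additive : WeightAdditive n (antisymm (coeffG2 n)) shiftQ := by
  intro i j hi hj hij hc
  rcases (by have := coeffG2_ne_zero hc; omega :
    (i = 1 ∧ 3 ≤ j) ∨ (i = 2 ∧ 3 ≤ j) ∨ (3 ≤ i ∧ j = 1) ∨ (3 ≤ i ∧ j = 2))
    with ⟨rfl, h⟩ | ⟨rfl, h⟩ | ⟨h, rfl⟩ | ⟨h, rfl⟩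
  all_goals
    unfold shiftQ
    split_ifs <;> first
      | (exfalso; omega)
      | ring

/-- The weights are `1`, `2` and `n, …, 2n - 3`. Two large weights sum to at least `2n`. Two small
ones sum to `2`, `3` or `4`, which is less than `n`; the value `2` belongs only to degree `2 = 1 +
1`, not to a higher one. -/
theorem shift_generic (hn : 6 ≤ n) : WeightGeneric n (antisymm (coeffG2 n))
    (fun i => shiftP i + n * shiftQ i) := by
  intro i j k hi hj hc hk hkn h
  simp only [shiftWeight_spec] at h
  have h1 : shiftWeight n k + 4 = shiftWeight n i + shiftWeight n j := by
    have : ((shiftWeight n k + 4 : ℕ) : ℂ) = (shiftWeight n i + shiftWeight n j : ℕ) := by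
      push_cast
      linear_combination h
    exact_mod_cast this
  unfold shiftWeight at h1
  rcases coeffG2_eq_zero hi hj (by omega) hc with h2 | h2 <;> split_ifs at h1 <;> omega

theorem torusExt_g2_isomorphic (hn : 6 ≤ n) :
    Isomorphic (torusExt (g2 n) ((gradedG2 n hn).diag shiftP) ((gradedG2 n hn).diag shiftQ))
      (R2 n) := by
  refine (gradedG2 n hn).torusExt_isomorphic_ofTable (σ := shiftIndex n) (fun _ => rfl)
    ?_ ?_ ?_ ?_ ?_ ?_ ?_ ?_ ?_ ?_
  · intro i hi hin
    have := @shiftIndex_cases n i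
    omega
  · intro a b _ hb
    rw [tableR2, if_neg (by omega), if_neg (by omega)]
  · intro a b ha hb
    unfold tableG2
    split_ifs <;> simp [e, Pi.single_apply]
    all_goals omega
  · intro a b ha hb
    unfold tableG2
    split_ifs <;> simp [e, Pi.single_apply]
    all_goals omega
  · intro i hi hin
    rcases @shiftIndex_cases n i with ⟨rfl, h⟩ | ⟨rfl, h⟩ | ⟨h1, h2, -, h⟩ | h
    · rw [h, tableR2, if_pos rfl, if_pos rfl, shiftP, if_pos rfl, one_smul]
    · rw [h, tableR2, if_pos rfl, if_neg (by omega), if_neg (by omega), if_pos rfl, shiftP,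
        if_neg (by omega), if_pos rfl]
    · rw [h, tableR2, if_pos rfl, if_neg (by omega), if_pos (by omega), shiftP,
        if_neg (by omega), if_neg (by omega), Nat.cast_sub hi]
      congr 1
      push_cast
      ring
    · omega
  · intro i hi hin
    rcases @shiftIndex_cases n i with ⟨rfl, h⟩ | ⟨rfl, h⟩ | ⟨h1, h2, -, h⟩ | h
    · rw [h, tableR2, if_neg (by omega), if_pos rfl, if_neg (by omega), shiftQ, if_pos rfl,
        zero_smul]
    · rw [h, tableR2, if_neg (by omega), if_pos rfl, if_neg (by omega), shiftQ,
        if_neg (by omega), if_pos rfl, zero_smul]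
    · rw [h, tableR2, if_neg (by omega), if_pos rfl, if_pos (by omega), shiftQ,
        if_neg (by omega), if_neg (by omega), one_smul]
    · omega
  · intro b hb
    rw [tableR2, if_neg (by omega), if_neg (by omega), tableG2, if_neg (by omega),
      if_neg (by omega)]
  · intro b hb
    rw [tableR2, if_neg (by omega), if_neg (by omega), tableG2, if_neg (by omega),
      if_neg (by omega)]
  · rw [tableR2, if_neg (by omega), if_pos rfl, if_neg (by omega)]
  · rw [tableR2, if_pos rfl, if_neg (by omega), if_neg (by omega), if_neg (by omega)]

theorem torusExt_g2_isLie (hn : 6 ≤ n) :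
    IsLie (torusExt (g2 n) ((gradedG2 n hn).diag shiftP) ((gradedG2 n hn).diag shiftQ)) :=
  torusExt_isLie ((gradedG2 n hn).isLie ofTable_self jacobi_coeffG2)
    ((gradedG2 n hn).diag_br shiftP_additive) ((gradedG2 n hn).diag_br shiftQ_additive)
    ((gradedG2 n hn).diag_comm _ _)

theorem R2_isLie (hn : 6 ≤ n) : IsLie (R2 n) :=
  (torusExt_g2_isLie hn).congr (torusExt_g2_isomorphic hn)

theorem R2_inFamily (hn : 6 ≤ n) : InFamily (g2 n) 2 (R2 n) := by
  refine InFamily.congr (torusExt_g2_isomorphic hn) ((gradedG2 n hn).torusExt_inFamily (g := 3)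
    (by omega) (by omega) (by omega) ?_ ?_ ?_ ?_ (torusExt_g2_isLie hn)) <;>
  norm_num [shiftP, shiftQ]

theorem isomorphic_R2 (hn : 6 ≤ n) {R : Type*} [AddCommGroup R] [Module ℂ R]
    {br : R →ₗ[ℂ] R →ₗ[ℂ] R} (h : InFamily (g2 n) 2 br) : Isomorphic br (R2 n) := by
  have hw : ∀ i k, shiftWeight n k ≠ shiftWeight n i →
      shiftP k + n * shiftQ k ≠ shiftP i + n * shiftQ i := by
    intro i k hne h
    rw [shiftWeight_spec, shiftWeight_spec, sub_left_inj] at h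
    exact hne (by exact_mod_cast h)
  refine Isomorphic.trans (Graded.RankTwo.isomorphic_torusExt (S := gradedG2 n hn) (g := 3)
    (shift_rankTwo hn (antisymm_swap _) (coeffG2_low (by omega) le_rfl) (fun i => coeffG2_one)
      (fun i => coeffG2_two)) (by omega) (by omega)
    (by omega) ofTable_skew
    (shift_center_le (gradedG2 n hn) hn (antisymm_swap _) (fun i => coeffG2_one)
      (fun i => coeffG2_two))
    shiftP_additive shiftQ_additive n ?_ ?_ (shift_generic hn) h)
    (torusExt_g2_isomorphic hn)
  · intro i hi hin h
    rw [shiftWeight_spec, sub_eq_zero] at h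
    have h1 : shiftWeight n i = 4 := by exact_mod_cast h
    unfold shiftWeight at h1
    split_ifs at h1 <;> omega
  · intro i k hi hik hkn
    apply hw
    unfold shiftWeight
    split_ifs <;> omega

end SecondFamily

/-! ### The exceptional algebras of dimensions 7, 9 and 11. -/

section Exceptional

theorem smul_e_eq {k l : ℕ} (h : k = l) (a : ℂ) : a • e k = (a • e k) l • e l := by
  subst h
  simp [e]

theorem e_eq {k l : ℕ} (h : k = l) : e k = e k l • e l := by
  simpa using smul_e_eq h 1

theorem neg_e_eq {k l : ℕ} (h : k = l) : -e k = (-e k) l • e l := by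
  subst h
  simp [e]

/-- The structure constants are read off as the coordinate of `T i j` in degree `i + j`. Only the
rows needed for triangularity and the entry `[f 2, f 3]`, which makes the weights proportional, have
to be evaluated. -/
theorem not_inFamily_of_table {n : ℕ} (hn : 6 ≤ n) (T : ℕ → ℕ → ℕ → ℂ)
    (hT : ∀ i j, T i j = T i j (i + j) • e (i + j))
    (h1 : ∀ i, 2 ≤ i → i + 2 ≤ n → antisymm (fun i j => T i j (i + j)) 1 i = 1)
    (h2 : antisymm (fun i j => T i j (i + j)) 2 (n - 2) ≠ 0)
    (h3 : antisymm (fun i j => T i j (i + j)) 2 3 ≠ 0)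
    {R : Type*} [AddCommGroup R] [Module ℂ R]
    {br : R →ₗ[ℂ] R →ₗ[ℂ] R} : ¬ InFamily (ofTable n T) 2 br := by
  refine (Graded.filiform_rankTwo (S := gradedOfTable n T _ hT) hn (antisymm_swap _) h1
    h2).not_inFamily_of_proportional (by omega) (by omega) (by omega) 2 fun D hD => ?_
  exact Graded.filiform_proportional _ hn (antisymm_swap _) h1 h2 h3 hD

variable {R : Type*} [AddCommGroup R] [Module ℂ R] {br : R →ₗ[ℂ] R →ₗ[ℂ] R}

theorem not_inFamily_g7 : ¬ InFamily g7 2 br := by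
  refine not_inFamily_of_table (by omega) table7 ?_ ?_ ?_ ?_
  · intro i j
    unfold table7
    split_ifs <;> first
      | exact e_eq (by omega)
      | exact smul_e_eq (by omega) _
      | simp
  · intro i hi hi'
    have : i ≤ 5 := by omega
    interval_cases i <;> simp [antisymm, table7, e]
  · simp [antisymm, table7, e]
  · simp [antisymm, table7, e]

theorem not_inFamily_g9 : ¬ InFamily g9 2 br := by
  refine not_inFamily_of_table (by omega) table9 ?_ ?_ ?_ ?_
  · intro i j
    unfold table9
    split_ifs <;> first
      | exact e_eq (by omega)
      | exact smul_e_eq (by omega) _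
      | simp
  · intro i hi hi'
    have : i ≤ 7 := by omega
    interval_cases i <;> simp [antisymm, table9, e]
  · simp [antisymm, table9, e]
  · simp [antisymm, table9, e]

theorem not_inFamily_g11 : ¬ InFamily g11 2 br := by
  refine not_inFamily_of_table (by omega) table11 ?_ ?_ ?_ ?_
  · intro i j
    unfold table11
    split_ifs <;> first
      | exact e_eq (by omega)
      | exact smul_e_eq (by omega) _
      | exact neg_e_eq (by omega)
      | simp
  · intro i hi hi'
    have : i ≤ 9 := by omega
    interval_cases i <;> simp [antisymm, table11, e]
  · simp [antisymm, table11, e]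
  · simp [antisymm, table11, e]

end Exceptional

end LeibnizAlg

theorem mainTheorem2 :
    (∀ n : ℕ, 6 ≤ n → Odd n →
      LeibnizAlg.IsLie (LeibnizAlg.R1 n) ∧
      LeibnizAlg.InFamily (LeibnizAlg.g1 n) 2 (LeibnizAlg.R1 n) ∧
      ∀ (R : Type*) [AddCommGroup R] [Module ℂ R] [FiniteDimensional ℂ R]
        (br : R →ₗ[ℂ] R →ₗ[ℂ] R),
        LeibnizAlg.InFamily (LeibnizAlg.g1 n) 2 br →
          LeibnizAlg.Isomorphic br (LeibnizAlg.R1 n)) ∧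
    (∀ n : ℕ, 6 ≤ n →
      LeibnizAlg.IsLie (LeibnizAlg.R2 n) ∧
      LeibnizAlg.InFamily (LeibnizAlg.g2 n) 2 (LeibnizAlg.R2 n) ∧
      ∀ (R : Type*) [AddCommGroup R] [Module ℂ R] [FiniteDimensional ℂ R]
        (br : R →ₗ[ℂ] R →ₗ[ℂ] R),
        LeibnizAlg.InFamily (LeibnizAlg.g2 n) 2 br →
          LeibnizAlg.Isomorphic br (LeibnizAlg.R2 n)) ∧
    (∀ (R : Type*) [AddCommGroup R] [Module ℂ R] [FiniteDimensional ℂ R]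
        (br : R →ₗ[ℂ] R →ₗ[ℂ] R),
      (∀ n : ℕ, 7 ≤ n → ¬ LeibnizAlg.InFamily (LeibnizAlg.g3 n) 2 br) ∧
      ¬ LeibnizAlg.InFamily LeibnizAlg.g7 2 br ∧
      ¬ LeibnizAlg.InFamily LeibnizAlg.g9 2 br ∧
      ¬ LeibnizAlg.InFamily LeibnizAlg.g11 2 br) := by
  exact ⟨fun n hn hodd => ⟨LeibnizAlg.R1_isLie hn hodd, LeibnizAlg.R1_inFamily hn hodd,
      fun R _ _ _ br h => LeibnizAlg.isomorphic_R1 hn hodd h⟩,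
    fun n hn => ⟨LeibnizAlg.R2_isLie hn, LeibnizAlg.R2_inFamily hn,
      fun R _ _ _ br h => LeibnizAlg.isomorphic_R2 hn h⟩,
    fun R _ _ _ br => ⟨fun n hn => LeibnizAlg.not_inFamily_g3 hn, LeibnizAlg.not_inFamily_g7,
      LeibnizAlg.not_inFamily_g9, LeibnizAlg.not_inFamily_g11⟩⟩
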